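/- Let $E=(E^0,E^1,r,s)$ be a row-finite directed graph, i.e. $r^{-1}(v)$ is finite for every $v\in E^0$ (loops, multiple edges and sources are allowed). A Cuntz–Krieger $E$-family in a $C^*$-algebra consists of mutually orthogonal projections $\{P_v\}_{v\in E^0}$ and partial isometries $\{S_e\}_{e\in E^1}$ such that $S_e^*S_e=P_{s(e)}$ for all $e\in E^1$ and $P_v=\sum_{r(f)=v}S_fS_f^*$ for every $v\in E^0$ with $r^{-1}(v)\neq\emptyset$. Let $C^*(E)$ be the $C^*$-algebra generated by a universal Cuntz–Krieger $E$-family $\{p_v,s_e\}$, and let $D_E\subseteq C^*(E)$ be the $C^*$-subalgebra generated by the projections $s_\mu s_\mu^*$, where $\mu$ runs over all finite paths $\mu=e_1e_2\cdots e_n$ in $E$ (so $r(e_{i+1})=s(e_i)$), $s_\mu=s_{e_1}s_{e_2}\cdots s_{e_n}$, including the paths of length $0$, i.e. the vertices $v$, for which $s_v=p_v$. If $E$ has no sources, i.e. $r^{-1}(v)\ne\emptyset$ for all $v$, then the $p_v$ may be omitted from this list of generators. The graph $E$ satisfies condition (L) if for every path $e_1e_2\cdots e_n$ with $n\ge 1$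 and $r(e_1)=s(e_n)$ there is an $i$ with $r^{-1}(r(e_i))\setminus\{e_i\}\neq\emptyset$. An ideal of a $C^*$-algebra $A$ is a closed two-sided ideal; for $X\subseteq A$ put $X^\perp=\{a\in A: ax=xa=0\text{ for all }x\in X\}$; an ideal $J$ is regular if $J=J^{\perp\perp}$. A $C^*$-subalgebra $B\subseteq A$ has the (regular) ideal intersection property in $A$ if $J\cap B\neq\{0\}$ for every non-zero (regular) ideal $J$ of $A$. Then the following are equivalent: 1. $E$ satisfies condition (L); 2. $D_E$ has the ideal intersection property in $C^*(E)$; 3. $D_E$ has the regular ideal intersection property in $C^*(E)$. -/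

import Mathlib

noncomputable section

/-! ## Directed graphs, row-finiteness, condition (L) -/

/-- A directed graph `E = (E⁰, E¹, r, s)` with vertex set `V`, edge set `W`, range map `r` and source
map `s`.  Loops and multiple edges are allowed. -/
structure DirectedGraph (V W : Type*) where
  /-- the range map -/
  r : W → V
  /-- the source map -/
  s : W → V

/-! ## The free `*`-algebra on the vertices and edges -/

/-- The alphabet `p_v` (`v` a vertex), `s_e`, `s_e^*` (`e` an edge). -/
inductive GraphLetter (V W : Type*) : Type _
  | vert (v : V) : GraphLetter V W
  | edge (e : W) : GraphLetter V W
  | edgeStar (e : W) : GraphLetter V W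

/-- The involution of the alphabet: `p_v` is fixed, `s_e` and `s_e^*` are exchanged. -/
def GraphLetter.conj {V W : Type*} : GraphLetter V W → GraphLetter V W
  | .vert v => .vert v
  | .edge e => .edgeStar e
  | .edgeStar e => .edge e

theorem GraphLetter.conj_conj {V W : Type*} (x : GraphLetter V W) : x.conj.conj = x := by
  cases x <;> rfl

/-- The involution on non-empty words: reverse the word and conjugate every letter. -/
def starWord {V W : Type*} :
    FreeSemigroup (GraphLetter V W) →ₙ* (FreeSemigroup (GraphLetter V W))ᵐᵒᵖ :=
  FreeSemigroup.lift fun x => MulOpposite.op (FreeSemigroup.of x.conj)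

instance FreeSemigroup.instStarMulGraphLetter {V W : Type*} :
    StarMul (FreeSemigroup (GraphLetter V W)) where
  star w := (starWord w).unop
  star_involutive w := by
    induction w using FreeSemigroup.recOnMul with
    | ih1 x => simp [starWord, GraphLetter.conj_conj]
    | ih2 x y hx hy => simp_all
  star_mul x y := by simp

section MonoidAlgebraStar

variable {S : Type*} [Semigroup S] [StarMul S]

/-- The conjugate-linear involution of a complex semigroup algebra which extends the involution of
the semigroup. -/
def MonoidAlgebra.starAux : MonoidAlgebra ℂ S →+ MonoidAlgebra ℂ S where
  toFun f := f.coeff.sum fun w c => MonoidAlgebra.single (star w) (star c)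
  map_zero' := by simp
  map_add' f g := by
    simp only [MonoidAlgebra.coeff_add]
    exact Finsupp.sum_add_index' (by simp) (by simp)

theorem MonoidAlgebra.starAux_single (w : S) (c : ℂ) :
    MonoidAlgebra.starAux (MonoidAlgebra.single w c) = MonoidAlgebra.single (star w) (star c) := by
  simp [MonoidAlgebra.starAux]

instance MonoidAlgebra.instStarRingSemigroup : StarRing (MonoidAlgebra ℂ S) where
  star := MonoidAlgebra.starAux
  star_involutive f := by
    induction f using MonoidAlgebra.induction_linear with
    | zero => simp
    | add f g hf hg => simp [map_add, hf, hg]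
    | single w c => simp [MonoidAlgebra.starAux_single]
  star_mul f g := by
    induction f using MonoidAlgebra.induction_linear with
    | zero => simp
    | add f₁ f₂ h₁ h₂ =>
      change starAux _ = starAux _ * starAux _ at h₁ h₂
      simp [add_mul, mul_add, map_add, h₁, h₂]
    | single w c =>
      induction g using MonoidAlgebra.induction_linear with
      | zero => simp
      | add g₁ g₂ h₁ h₂ =>
        change starAux _ = starAux _ * starAux _ at h₁ h₂
        simp [add_mul, mul_add, map_add, h₁, h₂]
      | single w' c' =>
        simp [MonoidAlgebra.single_mul_single, MonoidAlgebra.starAux_single, mul_comm]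
  star_add f g := map_add _ f g

theorem MonoidAlgebra.star_single_semigroup (w : S) (c : ℂ) :
    star (MonoidAlgebra.single w c) = MonoidAlgebra.single (star w) (star c) :=
  MonoidAlgebra.starAux_single w c

instance MonoidAlgebra.instStarModuleSemigroup : StarModule ℂ (MonoidAlgebra ℂ S) where
  star_smul c f := by
    induction f using MonoidAlgebra.induction_linear with
    | zero => simp
    | add f g hf hg => simp [smul_add, hf, hg]
    | single w d => simp [MonoidAlgebra.smul_single, MonoidAlgebra.star_single_semigroup]

end MonoidAlgebraStar

namespace DirectedGraph

variable {V W : Type*} (E : DirectedGraph V W)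

/-- `E` is row-finite: every vertex receives only finitely many edges. -/
def RowFinite : Prop := ∀ v : V, {e : W | E.r e = v}.Finite

/-- The edges `e 0, …, e n` form a return path `e₀ e₁ ⋯ eₙ` (of length `n + 1 ≥ 1`). -/
def IsReturnPath {n : ℕ} (e : Fin (n + 1) → W) : Prop :=
  (∀ i : Fin n, E.r (e i.succ) = E.s (e i.castSucc)) ∧ E.r (e 0) = E.s (e (Fin.last n))

/-- Condition (L): every return path has an entry. -/
def ConditionL : Prop :=
  ∀ (n : ℕ) (e : Fin (n + 1) → W), E.IsReturnPath e →
    ∃ i : Fin (n + 1), ({f : W | E.r f = E.r (e i)} \ {e i}).Nonempty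

/-! ## The universal `C*`-algebra of a Cuntz-Krieger `E`-family -/

/-- The free (non-unital) complex `*`-algebra on self-adjoint symbols `p_v` and symbols `s_e`.  The
parameter `E` records which seminorm it carries. -/
def FreeStarAlg (_E : DirectedGraph V W) : Type _ :=
  MonoidAlgebra ℂ (FreeSemigroup (GraphLetter V W))

namespace FreeStarAlg

instance : NonUnitalRing E.FreeStarAlg :=
  inferInstanceAs (NonUnitalRing (MonoidAlgebra ℂ (FreeSemigroup (GraphLetter V W))))

instance : StarRing E.FreeStarAlg :=
  inferInstanceAs (StarRing (MonoidAlgebra ℂ (FreeSemigroup (GraphLetter V W))))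

instance : Module ℂ E.FreeStarAlg :=
  inferInstanceAs (Module ℂ (MonoidAlgebra ℂ (FreeSemigroup (GraphLetter V W))))

instance : IsScalarTower ℂ E.FreeStarAlg E.FreeStarAlg :=
  inferInstanceAs (IsScalarTower ℂ (MonoidAlgebra ℂ (FreeSemigroup (GraphLetter V W)))
    (MonoidAlgebra ℂ (FreeSemigroup (GraphLetter V W))))

instance : SMulCommClass ℂ E.FreeStarAlg E.FreeStarAlg :=
  inferInstanceAs (SMulCommClass ℂ (MonoidAlgebra ℂ (FreeSemigroup (GraphLetter V W)))
    (MonoidAlgebra ℂ (FreeSemigroup (GraphLetter V W))))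

instance : StarModule ℂ E.FreeStarAlg :=
  inferInstanceAs (StarModule ℂ (MonoidAlgebra ℂ (FreeSemigroup (GraphLetter V W))))

/-- A word in the letters, as an element of the free `*`-algebra. -/
def word (w : FreeSemigroup (GraphLetter V W)) : E.FreeStarAlg :=
  MonoidAlgebra.single w 1

/-- The symbol `p_v`. -/
def p (v : V) : E.FreeStarAlg := word E (FreeSemigroup.of (.vert v))

/-- The symbol `s_e`. -/
def s (e : W) : E.FreeStarAlg := word E (FreeSemigroup.of (.edge e))

theorem star_word (w : FreeSemigroup (GraphLetter V W)) : star (word E w) = word E (star w) := by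
  refine (MonoidAlgebra.star_single_semigroup w 1).trans ?_
  simp [word]

theorem word_mul (w w' : FreeSemigroup (GraphLetter V W)) :
    word E (w * w') = word E w * word E w' := by
  refine Eq.trans ?_ (MonoidAlgebra.single_mul_single w w' (1 : ℂ) 1).symm
  rw [mul_one]
  rfl

theorem star_p (v : V) : star (p E v) = p E v := star_word E _

end FreeStarAlg

/-- The Cuntz-Krieger relations of a row-finite graph, as elements of the free `*`-algebra which have
to vanish: the `p_v` are mutually orthogonal projections (self-adjointness is built into the free
`*`-algebra), `s_e^* s_e = p_{s(e)}`, and `p_v = ∑_{r(e) = v} s_e s_e^*` for every vertex `v` which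
receives an edge. -/
inductive CKRelation : E.FreeStarAlg → Prop
  | proj (v : V) : CKRelation (FreeStarAlg.p E v * FreeStarAlg.p E v - FreeStarAlg.p E v)
  | orth (v w : V) (h : v ≠ w) : CKRelation (FreeStarAlg.p E v * FreeStarAlg.p E w)
  | source (e : W) : CKRelation (star (FreeStarAlg.s E e) * FreeStarAlg.s E e - FreeStarAlg.p E (E.s e))
  | range (v : V) (hfin : {e : W | E.r e = v}.Finite) (hne : {e : W | E.r e = v}.Nonempty) :
      CKRelation (FreeStarAlg.p E v - ∑ e ∈ hfin.toFinset, FreeStarAlg.s E e * star (FreeStarAlg.s E e))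

/-- A `C*`-seminorm on the free `*`-algebra which satisfies the Cuntz-Krieger relations, that is, the
pull-back of the norm of a `C*`-algebra under the `*`-homomorphism given by a Cuntz-Krieger
`E`-family. -/
structure IsCKSeminorm (N : Seminorm ℂ E.FreeStarAlg) : Prop where
  mul_le : ∀ a b, N (a * b) ≤ N a * N b
  star_mul_self : ∀ a, N (star a * a) = N a ^ 2
  relation : ∀ a, E.CKRelation a → N a = 0

namespace IsCKSeminorm

variable {E} {N : Seminorm ℂ E.FreeStarAlg}

theorem le_of_relation (hN : E.IsCKSeminorm N) {a b : E.FreeStarAlg}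
    (h : E.CKRelation (a - b)) : N a ≤ N b := by
  have h1 := map_add_le_add N (a - b) b
  rw [sub_add_cancel, hN.relation _ h, zero_add] at h1
  exact h1

theorem map_star (hN : E.IsCKSeminorm N) (a : E.FreeStarAlg) : N (star a) = N a := by
  have key : ∀ a, N a ≤ N (star a) := fun a => by
    have h := hN.mul_le (star a) a
    rw [hN.star_mul_self, sq] at h
    rcases (apply_nonneg N a).eq_or_lt with h0 | h0
    · rw [← h0]; exact apply_nonneg N _
    · exact le_of_mul_le_mul_right h h0
  refine le_antisymm ?_ (key a)
  simpa using key (star a)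

theorem p_le_one (hN : E.IsCKSeminorm N) (v : V) : N (FreeStarAlg.p E v) ≤ 1 := by
  have h1 := hN.star_mul_self (FreeStarAlg.p E v)
  rw [FreeStarAlg.star_p] at h1
  have h2 := hN.le_of_relation (CKRelation.proj v)
  rw [h1] at h2
  nlinarith [apply_nonneg N (FreeStarAlg.p E v)]

theorem s_le_one (hN : E.IsCKSeminorm N) (e : W) : N (FreeStarAlg.s E e) ≤ 1 := by
  have h1 := hN.star_mul_self (FreeStarAlg.s E e)
  have h2 := hN.le_of_relation (CKRelation.source e)
  have h3 := hN.p_le_one (E.s e)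
  rw [h1] at h2
  nlinarith [apply_nonneg N (FreeStarAlg.s E e)]

theorem word_le_one (hN : E.IsCKSeminorm N) (w : FreeSemigroup (GraphLetter V W)) :
    N (FreeStarAlg.word E w) ≤ 1 := by
  induction w using FreeSemigroup.recOnMul with
  | ih1 x =>
    cases x with
    | vert v => exact hN.p_le_one v
    | edge e => exact hN.s_le_one e
    | edgeStar e =>
      have h : FreeStarAlg.word E (FreeSemigroup.of (.edgeStar e)) = star (FreeStarAlg.s E e) :=
        (FreeStarAlg.star_word E (FreeSemigroup.of (.edge e))).symm
      rw [h, hN.map_star]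
      exact hN.s_le_one e
  | ih2 x y hx hy =>
    rw [FreeStarAlg.word_mul]
    exact (hN.mul_le _ _).trans (mul_le_one₀ hx (apply_nonneg _ _) hy)

end IsCKSeminorm

theorem bound_exists (a : E.FreeStarAlg) :
    ∃ C : ℝ, ∀ N : Seminorm ℂ E.FreeStarAlg, E.IsCKSeminorm N → N a ≤ C := by
  induction a using MonoidAlgebra.induction_linear with
  | zero => exact ⟨0, fun N _ => (map_zero N).le⟩
  | add f g hf hg =>
    obtain ⟨C, hC⟩ := hf
    obtain ⟨D, hD⟩ := hg
    exact ⟨C + D, fun N hN => (map_add_le_add N f g).trans (add_le_add (hC N hN) (hD N hN))⟩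
  | single w c =>
    refine ⟨‖c‖, fun N hN => ?_⟩
    have h : (MonoidAlgebra.single w c : MonoidAlgebra ℂ (FreeSemigroup (GraphLetter V W)))
        = c • (MonoidAlgebra.single w 1 : MonoidAlgebra ℂ (FreeSemigroup (GraphLetter V W))) := by
      simp [MonoidAlgebra.smul_single]
    rw [h]
    refine (map_smul_eq_mul N c (FreeStarAlg.word E w)).le.trans ?_
    exact mul_le_of_le_one_right (norm_nonneg _) (hN.word_le_one w)

theorem isCKSeminorm_zero : E.IsCKSeminorm 0 where
  mul_le := by simp
  star_mul_self := by simp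
  relation := by simp

instance : Nonempty {N : Seminorm ℂ E.FreeStarAlg // E.IsCKSeminorm N} :=
  ⟨⟨0, E.isCKSeminorm_zero⟩⟩

/-- The universal `C*`-seminorm: the supremum of all `C*`-seminorms which satisfy the Cuntz-Krieger
relations. -/
def univNorm (a : E.FreeStarAlg) : ℝ :=
  ⨆ N : {N : Seminorm ℂ E.FreeStarAlg // E.IsCKSeminorm N}, N.1 a

theorem bddAbove_univNorm (a : E.FreeStarAlg) :
    BddAbove (Set.range fun N : {N : Seminorm ℂ E.FreeStarAlg // E.IsCKSeminorm N} => N.1 a) := by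
  obtain ⟨C, hC⟩ := E.bound_exists a
  exact ⟨C, by rintro _ ⟨N, rfl⟩; exact hC N.1 N.2⟩

theorem le_univNorm {N : Seminorm ℂ E.FreeStarAlg} (hN : E.IsCKSeminorm N) (a : E.FreeStarAlg) :
    N a ≤ E.univNorm a :=
  le_ciSup (E.bddAbove_univNorm a) ⟨N, hN⟩

theorem univNorm_le {a : E.FreeStarAlg} {C : ℝ}
    (h : ∀ N : Seminorm ℂ E.FreeStarAlg, E.IsCKSeminorm N → N a ≤ C) : E.univNorm a ≤ C :=
  ciSup_le fun N => h N.1 N.2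

theorem univNorm_nonneg (a : E.FreeStarAlg) : 0 ≤ E.univNorm a :=
  le_univNorm E E.isCKSeminorm_zero a

/-- The universal `C*`-seminorm as a seminorm. -/
def univSeminorm : Seminorm ℂ E.FreeStarAlg :=
  Seminorm.ofSMulLE E.univNorm
    (le_antisymm (E.univNorm_le fun N _ => (map_zero N).le) (E.univNorm_nonneg 0))
    (fun a b => E.univNorm_le fun N hN => (map_add_le_add N a b).trans
      (add_le_add (E.le_univNorm hN a) (E.le_univNorm hN b)))
    (fun c a => E.univNorm_le fun N hN => (map_smul_eq_mul N c a).le.trans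
      (mul_le_mul_of_nonneg_left (E.le_univNorm hN a) (norm_nonneg c)))

theorem isCKSeminorm_univSeminorm : E.IsCKSeminorm E.univSeminorm where
  mul_le a b := E.univNorm_le fun N hN => (hN.mul_le a b).trans
    (mul_le_mul (E.le_univNorm hN a) (E.le_univNorm hN b) (apply_nonneg N b) (E.univNorm_nonneg a))
  star_mul_self a := by
    refine le_antisymm (E.univNorm_le fun N hN => ?_) ?_
    · rw [hN.star_mul_self]
      exact pow_le_pow_left₀ (apply_nonneg N a) (E.le_univNorm hN a) 2
    · have h0 : 0 ≤ E.univNorm (star a * a) := E.univNorm_nonneg _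
      change E.univNorm a ^ 2 ≤ E.univNorm (star a * a)
      rw [← Real.sq_sqrt h0]
      refine pow_le_pow_left₀ (E.univNorm_nonneg a) (E.univNorm_le fun N hN => ?_) 2
      refine Real.le_sqrt_of_sq_le ?_
      rw [← hN.star_mul_self]
      exact E.le_univNorm hN _
  relation a ha := le_antisymm (E.univNorm_le fun N hN => (hN.relation a ha).le)
    (E.univNorm_nonneg a)

namespace FreeStarAlg

instance : SeminormedAddCommGroup E.FreeStarAlg :=
  E.univSeminorm.toAddGroupSeminorm.toSeminormedAddCommGroup

theorem norm_def (a : E.FreeStarAlg) : ‖a‖ = E.univSeminorm a := rfl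

instance : NonUnitalSeminormedRing E.FreeStarAlg where
  __ : NonUnitalRing E.FreeStarAlg := inferInstance
  __ : SeminormedAddCommGroup E.FreeStarAlg := inferInstance
  norm_mul_le := E.isCKSeminorm_univSeminorm.mul_le

instance : NormedSpace ℂ E.FreeStarAlg where
  norm_smul_le c a := (map_smul_eq_mul E.univSeminorm c a).le

instance : NormedStarGroup E.FreeStarAlg where
  norm_star_le a := (E.isCKSeminorm_univSeminorm.map_star a).le

end FreeStarAlg

/-- The graph `C*`-algebra `C*(E)` of a row-finite graph: the Hausdorff completion of the free
`*`-algebra in the universal `C*`-seminorm. -/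
def CStarAlg : Type _ := UniformSpace.Completion E.FreeStarAlg

namespace CStarAlg

open UniformSpace UniformSpace.Completion

instance : NormedAddCommGroup E.CStarAlg :=
  inferInstanceAs (NormedAddCommGroup (Completion E.FreeStarAlg))

instance : NormedSpace ℂ E.CStarAlg :=
  inferInstanceAs (NormedSpace ℂ (Completion E.FreeStarAlg))

instance : CompleteSpace E.CStarAlg :=
  inferInstanceAs (CompleteSpace (Completion E.FreeStarAlg))

/-- The canonical map from the free `*`-algebra to `C*(E)`. -/
def of : E.FreeStarAlg →ₗᵢ[ℂ] E.CStarAlg :=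
  (toComplₗᵢ : E.FreeStarAlg →ₗᵢ[ℂ] Completion E.FreeStarAlg)

theorem isDenseInducing_of : IsDenseInducing (of E) :=
  (isDenseInducing_coe : IsDenseInducing ((↑) : E.FreeStarAlg → Completion E.FreeStarAlg))

/-- The product of `C*(E)`: the continuous extension of the product of the free `*`-algebra. -/
instance : Mul E.CStarAlg :=
  ⟨fun x y => ((isDenseInducing_of E).prodMap (isDenseInducing_of E)).extend
    (fun q : E.FreeStarAlg × E.FreeStarAlg => of E (q.1 * q.2)) (x, y)⟩

theorem of_mul (a b : E.FreeStarAlg) : of E (a * b) = of E a * of E b :=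
  (((isDenseInducing_of E).prodMap (isDenseInducing_of E)).extend_eq
    ((of E).continuous.comp continuous_mul) (a, b)).symm

instance : ContinuousMul E.CStarAlg where
  continuous_mul := by
    let m : E.FreeStarAlg →+ E.FreeStarAlg →+ E.CStarAlg :=
      (AddMonoidHom.mul : E.FreeStarAlg →+ _).compr₂ (of E).toLinearMap.toAddMonoidHom
    have hm : Continuous fun q : E.FreeStarAlg × E.FreeStarAlg => m q.1 q.2 :=
      (of E).continuous.comp continuous_mul
    have di : IsDenseInducing ((of E).toLinearMap.toAddMonoidHom : E.FreeStarAlg → E.CStarAlg) :=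
      isDenseInducing_of E
    exact di.extend_Z_bilin di hm

/-- The involution of `C*(E)`: the continuous extension of the involution of the free `*`-algebra. -/
instance : Star E.CStarAlg :=
  ⟨(isDenseInducing_of E).extend fun a => of E (star a)⟩

theorem of_star (a : E.FreeStarAlg) : of E (star a) = star (of E a) :=
  ((isDenseInducing_of E).extend_eq ((of E).continuous.comp continuous_star) a).symm

instance : ContinuousStar E.CStarAlg where
  continuous_star := by
    have h : UniformContinuous fun a : E.FreeStarAlg => of E (star a) := by
      have h1 : Isometry (starAddEquiv : E.FreeStarAlg ≃+ E.FreeStarAlg) :=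
        AddMonoidHomClass.isometry_of_norm _ (fun a => norm_star a)
      exact ((of E).isometry.comp h1).uniformContinuous
    exact (uniformContinuous_uniformly_extend (of E).isometry.isUniformInducing
      (isDenseInducing_of E).dense h).continuous

variable {E}

@[elab_as_elim]
theorem induction_on {P : E.CStarAlg → Prop} (x : E.CStarAlg) (hc : IsClosed {x | P x})
    (h : ∀ a, P (of E a)) : P x :=
  (isDenseInducing_of E).dense.induction_on x hc h

@[elab_as_elim]
theorem induction_on₂ {P : E.CStarAlg → E.CStarAlg → Prop} (x y : E.CStarAlg)
    (hc : IsClosed {q : E.CStarAlg × E.CStarAlg | P q.1 q.2})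
    (h : ∀ a b, P (of E a) (of E b)) : P x y :=
  Completion.induction_on₂ (α := E.FreeStarAlg) (β := E.FreeStarAlg) x y hc h

@[elab_as_elim]
theorem induction_on₃ {P : E.CStarAlg → E.CStarAlg → E.CStarAlg → Prop} (x y z : E.CStarAlg)
    (hc : IsClosed {q : E.CStarAlg × E.CStarAlg × E.CStarAlg | P q.1 q.2.1 q.2.2})
    (h : ∀ a b c, P (of E a) (of E b) (of E c)) : P x y z :=
  Completion.induction_on₃ (α := E.FreeStarAlg) (β := E.FreeStarAlg) (γ := E.FreeStarAlg)
    x y z hc h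

variable (E)

instance : NonUnitalRing E.CStarAlg where
  __ : AddCommGroup E.CStarAlg := inferInstance
  __ : Mul E.CStarAlg := inferInstance
  left_distrib x y z := by
    refine induction_on₃ x y z (isClosed_eq (by fun_prop) (by fun_prop)) fun a b c => ?_
    rw [← map_add, ← of_mul, ← of_mul, ← of_mul, ← map_add, mul_add]
  right_distrib x y z := by
    refine induction_on₃ x y z (isClosed_eq (by fun_prop) (by fun_prop)) fun a b c => ?_
    rw [← map_add, ← of_mul, ← of_mul, ← of_mul, ← map_add, add_mul]
  zero_mul x := by
    refine induction_on x (isClosed_eq (by fun_prop) (by fun_prop)) fun a => ?_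
    rw [← map_zero (of E), ← of_mul, zero_mul]
  mul_zero x := by
    refine induction_on x (isClosed_eq (by fun_prop) (by fun_prop)) fun a => ?_
    rw [← map_zero (of E), ← of_mul, mul_zero]
  mul_assoc x y z := by
    refine induction_on₃ x y z (isClosed_eq (by fun_prop) (by fun_prop)) fun a b c => ?_
    rw [← of_mul, ← of_mul, ← of_mul, ← of_mul, mul_assoc]

instance : StarRing E.CStarAlg where
  star_involutive x := by
    refine induction_on x (isClosed_eq (by fun_prop) (by fun_prop)) fun a => ?_
    rw [← of_star, ← of_star, star_star]
  star_mul x y := by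
    refine induction_on₂ x y (isClosed_eq (by fun_prop) (by fun_prop)) fun a b => ?_
    rw [← of_mul, ← of_star, ← of_star, ← of_star, ← of_mul, star_mul]
  star_add x y := by
    refine induction_on₂ x y (isClosed_eq (by fun_prop) (by fun_prop)) fun a b => ?_
    rw [← map_add, ← of_star, ← of_star, ← of_star, ← map_add, star_add]

instance : NonUnitalNormedRing E.CStarAlg where
  __ : NonUnitalRing E.CStarAlg := inferInstance
  __ : NormedAddCommGroup E.CStarAlg := inferInstance
  norm_mul_le x y := by
    refine induction_on₂ x y (isClosed_le (by fun_prop) (by fun_prop)) fun a b => ?_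
    rw [← of_mul, LinearIsometry.norm_map, LinearIsometry.norm_map, LinearIsometry.norm_map]
    exact norm_mul_le a b

instance : CStarRing E.CStarAlg where
  norm_mul_self_le x := by
    refine induction_on x (isClosed_le (by fun_prop) (by fun_prop)) fun a => ?_
    rw [← of_star, ← of_mul, LinearIsometry.norm_map, LinearIsometry.norm_map,
      FreeStarAlg.norm_def, FreeStarAlg.norm_def,
      E.isCKSeminorm_univSeminorm.star_mul_self, sq]

instance : IsScalarTower ℂ E.CStarAlg E.CStarAlg where
  smul_assoc c x y := by
    have h1 : Continuous fun q : E.CStarAlg × E.CStarAlg => (c • q.1) * q.2 :=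
      (continuous_fst.const_smul c).mul continuous_snd
    have h2 : Continuous fun q : E.CStarAlg × E.CStarAlg => c • (q.1 * q.2) :=
      (continuous_fst.mul continuous_snd).const_smul c
    change (c • x) * y = c • (x * y)
    refine induction_on₂ x y (isClosed_eq h1 h2) fun a b => ?_
    rw [← map_smul, ← of_mul, ← of_mul, ← map_smul, smul_mul_assoc]

instance : SMulCommClass ℂ E.CStarAlg E.CStarAlg where
  smul_comm c x y := by
    have h1 : Continuous fun q : E.CStarAlg × E.CStarAlg => c • (q.1 * q.2) :=
      (continuous_fst.mul continuous_snd).const_smul c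
    have h2 : Continuous fun q : E.CStarAlg × E.CStarAlg => q.1 * (c • q.2) :=
      continuous_fst.mul (continuous_snd.const_smul c)
    change c • (x * y) = x * (c • y)
    refine induction_on₂ x y (isClosed_eq h1 h2) fun a b => ?_
    rw [← map_smul, ← of_mul, ← of_mul, ← map_smul, mul_smul_comm]

instance : StarModule ℂ E.CStarAlg where
  star_smul c x := by
    have h1 : Continuous fun x : E.CStarAlg => star (c • x) :=
      (continuous_id.const_smul c).star
    have h2 : Continuous fun x : E.CStarAlg => star c • star x :=
      continuous_id.star.const_smul (star c)
    refine induction_on x (isClosed_eq h1 h2) fun a => ?_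
    rw [← map_smul, ← of_star, ← of_star, ← map_smul, star_smul]

instance : NonUnitalCStarAlgebra E.CStarAlg where

/-- The vertex projection `p_v ∈ C*(E)`. -/
def p (v : V) : E.CStarAlg := of E (FreeStarAlg.p E v)

/-- The edge partial isometry `s_e ∈ C*(E)`. -/
def s (e : W) : E.CStarAlg := of E (FreeStarAlg.s E e)

/-- The product `s_{e₁} s_{e₂} ⋯ s_{eₙ} ∈ C*(E)` for the non-empty list `e₁, e₂, …, eₙ`, whose head is
`e` and whose tail is `l`.  (It is zero unless `e₁ e₂ ⋯ eₙ` is a path.) -/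
def sPath : W → List W → E.CStarAlg
  | e, [] => s E e
  | e, f :: l => s E e * sPath f l

/-- The diagonal subalgebra `D_E`: the `C*`-subalgebra of `C*(E)` generated by the projections
`s_μ s_μ^*`, where `μ` runs through the finite paths, including the paths of length zero (vertices
`v`, with `s_v = p_v`). -/
def diagonal : NonUnitalStarSubalgebra ℂ E.CStarAlg :=
  (NonUnitalStarAlgebra.adjoin ℂ
    (Set.range (p E) ∪
      {x | ∃ (e : W) (l : List W), x = sPath E e l * star (sPath E e l)})).topologicalClosure

end CStarAlg

end DirectedGraph

/-! ## Regular ideals and intersection properties -/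

section Ideals

variable {A : Type*} [NonUnitalCStarAlgebra A]

/-- `J` is a (closed, two-sided) ideal of the `C*`-algebra `A`. -/
structure IsCStarIdeal (J : Submodule ℂ A) : Prop where
  isClosed : IsClosed (J : Set A)
  mul_mem_left : ∀ a x : A, x ∈ J → a * x ∈ J
  mul_mem_right : ∀ a x : A, x ∈ J → x * a ∈ J

/-- `X^⊥ = {a ∈ A : a x = x a = 0 for all x ∈ X}`. -/
def annihilatorPerp (X : Set A) : Set A := {a | ∀ x ∈ X, a * x = 0 ∧ x * a = 0}

/-- `J` is a regular ideal: an ideal with `J = J^⊥⊥`. -/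
def IsRegularIdeal (J : Submodule ℂ A) : Prop :=
  IsCStarIdeal J ∧ (J : Set A) = annihilatorPerp (annihilatorPerp (J : Set A))

/-- `B` has the ideal intersection property in `A`. -/
def HasIdealIntersectionProperty (B : NonUnitalStarSubalgebra ℂ A) : Prop :=
  ∀ J : Submodule ℂ A, IsCStarIdeal J → J ≠ ⊥ → ∃ x ∈ J, x ∈ B ∧ x ≠ 0

/-- `B` has the regular ideal intersection property in `A`. -/
def HasRegularIdealIntersectionProperty (B : NonUnitalStarSubalgebra ℂ A) : Prop :=
  ∀ J : Submodule ℂ A, IsRegularIdeal J → J ≠ ⊥ → ∃ x ∈ J, x ∈ B ∧ x ≠ 0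

end Ideals

end

/-!
The equivalence rests on a uniqueness theorem for graphs with condition (L) and on a construction
of a regular ideal from a cycle without entry.

**Condition (L) implies the ideal intersection property.** The span of the monomials `s_μ s_ν^*`
is dense in `C*(E)` (`CStarAlg.dense_monomialSpan`). The graph acts on `ℓ²` of its boundary paths
(`boundaryFamily`), so no `p_v` vanishes, and the circle acts on `C*(E)` by the gauge action. The
average over the circle is a faithful expectation `Φ` (`CStarAlg.eq_zero_of_expectation_eq_zero`)
onto the closed span of the monomials with `|μ| = |ν|`. Any finite linear combination of these
lies in a finite-dimensional `*`-algebra spanned by matrix units, so a homomorphism which does not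
kill any `p_v` is isometric there (`CStarAlg.norm_map_of_mem_core`). Applied to the boundary path
representation this gives, for each `a ≠ 0`, a boundary path `x` with `⟨δ_x, Φ(a^* a) δ_x⟩ ≠ 0`
(`CStarAlg.exists_diagFunctional_ne_zero`).

Condition (L) provides, for each boundary path `x` and each `M`, a path `τ` which follows `x` for
`M` steps and continues without any period `≤ M` (or ends at a source), so that `s_τ^* s_μ s_ν^*
s_τ` is either zero or a vertex projection whenever `|μ|, |ν| ≤ M` (`CKFamily.exists_separates`).
If a closed ideal `J` contains `b = a^* a`, then approximating `b` by a finite combination of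
monomials and compressing by `s_τ` produces a vertex projection at distance less than one from
`J`; it belongs to `J` by `mem_of_norm_sub_lt`, and it lies in the diagonal.

The regular ideal intersection property follows at once, because regular ideals are ideals.

**The regular ideal intersection property implies condition (L).** If a cycle has no entry and `q`
is the projection of one of its vertices, the loop `w` around the cycle commutes with the corner
`q C*(E) q`, and the squares `f, g` of the positive and the negative part of `w + w^*` are
non-zero with `f g = 0`: the gauge action has an element which maps `w` to `-w` and exchanges `f`
and `g` (`EntrylessCycle.exists_orthogonal`). Let `Y` be the annihilator of the ideal generated by
`q`, and let `J` be the annihilator of the union of `Y` and the ideal generated by `g`. Then `J`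
is regular and contains `f`. An element `d` of the diagonal acts as a scalar on each path `μ`
which starts on the cycle (`EntrylessCycle.diagonal_mul_path_mem`); if `d ∈ J`, then `d s_μ g = 0`
forces this scalar to vanish, so that `d` and `d^*` belong to `Y`, and hence `d d^* = 0`.
-/

noncomputable section

/-! ### Preliminaries on C*-algebras -/

theorem continuous_nonUnitalStarAlgHom {A B : Type*} [NonUnitalCStarAlgebra A]
    [NonUnitalCStarAlgebra B] (φ : A →⋆ₙₐ[ℂ] B) : Continuous φ :=
  AddMonoidHomClass.continuous_of_bound φ 1 fun a => by
    simpa using NonUnitalStarAlgHom.norm_apply_le φ a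

section Projections

variable {B : Type*} [NonUnitalCStarAlgebra B]

theorem eq_zero_of_sum_star_mul_self_eq_zero {ι : Type*} {t : Finset ι} {x : ι → B}
    (h : ∑ i ∈ t, star (x i) * x i = 0) {i : ι} (hi : i ∈ t) : x i = 0 := by
  let _ := CStarAlgebra.spectralOrder B
  have _ := CStarAlgebra.spectralOrderedRing B
  exact CStarRing.star_mul_self_eq_zero_iff _ |>.1
    ((Finset.sum_eq_zero_iff_of_nonneg fun j _ => star_mul_self_nonneg (x j)).1 h i hi)

/-- A summand of a projection which is a finite sum of projections lies below the sum. -/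
theorem mul_sum_eq_self_of_projections {ι : Type*} {t : Finset ι} {q : ι → B} {p : B}
    (hq : ∀ i ∈ t, star (q i) = q i ∧ q i * q i = q i) (hp : star p = p) (hpp : p * p = p)
    (h : p = ∑ i ∈ t, q i) {i : ι} (hi : i ∈ t) : q i * p = q i := by
  have key : ∑ j ∈ t, star (q j - q j * p) * (q j - q j * p) = 0 := by
    have : ∀ j ∈ t, star (q j - q j * p) * (q j - q j * p)
        = q j - q j * p - (p * q j - p * q j * p) := by
      intro j hj
      obtain ⟨h1, h2⟩ := hq j hj
      rw [star_sub, star_mul, h1, hp, sub_mul, mul_sub, mul_sub, ← mul_assoc, h2, mul_assoc p, h2,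
        ← mul_assoc, mul_assoc p, h2]
    rw [Finset.sum_congr rfl this]
    simp only [Finset.sum_sub_distrib, ← Finset.sum_mul, ← Finset.mul_sum, ← h, hpp, sub_self]
  exact (sub_eq_zero.1 (eq_zero_of_sum_star_mul_self_eq_zero key hi)).symm

/-- Projections whose sum is a projection are mutually orthogonal: compressing the sum to one of
them leaves no room for the others. -/
theorem mul_eq_zero_of_projections {ι : Type*} {t : Finset ι} {q : ι → B} {p : B}
    (hq : ∀ i ∈ t, star (q i) = q i ∧ q i * q i = q i) (hp : star p = p) (hpp : p * p = p)
    (h : p = ∑ i ∈ t, q i) {i j : ι} (hi : i ∈ t) (hj : j ∈ t) (hij : i ≠ j) : q i * q j = 0 := by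
  classical
  have h1 : ∑ k ∈ t, star (q k * q j) * (q k * q j) = q j := by
    have : ∀ k ∈ t, star (q k * q j) * (q k * q j) = q j * q k * q j := by
      intro k hk
      obtain ⟨h1, h2⟩ := hq k hk
      rw [star_mul, h1, (hq j hj).1, mul_assoc, ← mul_assoc (q k), h2, mul_assoc]
    rw [Finset.sum_congr rfl this, ← Finset.sum_mul, ← Finset.mul_sum, ← h,
      mul_sum_eq_self_of_projections hq hp hpp h hj, (hq j hj).2]
  rw [← Finset.add_sum_erase _ _ hj, (hq j hj).2, (hq j hj).1, (hq j hj).2, add_eq_left] at h1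
  exact eq_zero_of_sum_star_mul_self_eq_zero h1 (Finset.mem_erase.2 ⟨hij, hi⟩)

end Projections

/-! ### Cuntz-Krieger families -/

namespace DirectedGraph

variable {V W : Type*} {E : DirectedGraph V W}

/-- A Cuntz-Krieger `E`-family in a `C*`-algebra `B`. -/
structure CKFamily (E : DirectedGraph V W) (B : Type*) [NonUnitalCStarAlgebra B] where
  /-- the vertex projections -/
  P : V → B
  /-- the edge partial isometries -/
  S : W → B
  star_P : ∀ v, star (P v) = P v
  P_mul_self : ∀ v, P v * P v = P v
  P_mul_P : ∀ v w, v ≠ w → P v * P w = 0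
  star_S_mul_self : ∀ e, star (S e) * S e = P (E.s e)
  P_eq_sum : ∀ (v : V) (hfin : {e : W | E.r e = v}.Finite), {e : W | E.r e = v}.Nonempty →
    P v = ∑ e ∈ hfin.toFinset, S e * star (S e)

/-- The range of the path with edges `l` and source `v`; a path of length zero has range `v`. -/
def rangeOf (E : DirectedGraph V W) : List W → V → V
  | [], v => v
  | e :: _, _ => E.r e

/-- The list of edges `l` is a path with source `v`. -/
def IsPath (E : DirectedGraph V W) : List W → V → Prop
  | [], _ => True
  | e :: l, v => E.s e = E.rangeOf l v ∧ IsPath E l v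

@[simp] theorem rangeOf_nil (v : V) : E.rangeOf [] v = v := rfl
@[simp] theorem rangeOf_cons (e : W) (l : List W) (v : V) : E.rangeOf (e :: l) v = E.r e := rfl
@[simp] theorem isPath_nil (v : V) : E.IsPath [] v := trivial
@[simp] theorem isPath_cons (e : W) (l : List W) (v : V) :
    E.IsPath (e :: l) v ↔ E.s e = E.rangeOf l v ∧ E.IsPath l v := Iff.rfl

theorem rangeOf_append (μ α : List W) (v : V) :
    E.rangeOf (μ ++ α) v = E.rangeOf μ (E.rangeOf α v) := by
  cases μ <;> rfl

theorem isPath_append (μ α : List W) (v : V) :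
    E.IsPath (μ ++ α) v ↔ E.IsPath μ (E.rangeOf α v) ∧ E.IsPath α v := by
  induction μ with
  | nil => simp
  | cons e μ ih => simp [rangeOf_append, ih, and_assoc]

theorem IsPath.source_unique {e : W} {l : List W} {v w : V} (h : E.IsPath (e :: l) v)
    (h' : E.IsPath (e :: l) w) : v = w := by
  induction l generalizing e with
  | nil => exact h.1.symm.trans h'.1
  | cons f l ih => exact ih h.2 h'.2

namespace CKFamily

variable {B : Type*} [NonUnitalCStarAlgebra B] (F : E.CKFamily B)

theorem S_mul_P (e : W) : F.S e * F.P (E.s e) = F.S e := by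
  rw [← sub_eq_zero, ← CStarRing.star_mul_self_eq_zero_iff]
  have h : F.P (E.s e) * star (F.S e) * F.S e = F.P (E.s e) := by
    rw [mul_assoc, F.star_S_mul_self, F.P_mul_self]
  rw [star_sub, star_mul, F.star_P, sub_mul, mul_sub, mul_sub, ← mul_assoc, ← mul_assoc, h,
    F.star_S_mul_self, F.P_mul_self, sub_self]

theorem S_mul_star_S_mul_S (e : W) : F.S e * star (F.S e) * F.S e = F.S e := by
  rw [mul_assoc, F.star_S_mul_self, F.S_mul_P]

theorem projection_S_mul_star_S (e : W) : star (F.S e * star (F.S e)) = F.S e * star (F.S e) ∧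
    F.S e * star (F.S e) * (F.S e * star (F.S e)) = F.S e * star (F.S e) := by
  refine ⟨by simp, ?_⟩
  rw [← mul_assoc, F.S_mul_star_S_mul_S]

theorem P_mul_S (hE : E.RowFinite) (e : W) : F.P (E.r e) * F.S e = F.S e := by
  have h := mul_sum_eq_self_of_projections (q := fun e => F.S e * star (F.S e))
    (fun i _ => F.projection_S_mul_star_S i) (F.star_P _) (F.P_mul_self _)
    (F.P_eq_sum (E.r e) (hE _) ⟨e, rfl⟩) (i := e) (by simp)
  have h2 := congrArg star h
  simp only [star_mul, star_star, F.star_P] at h2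
  calc F.P (E.r e) * F.S e = F.P (E.r e) * (F.S e * star (F.S e)) * F.S e := by
        rw [mul_assoc, F.S_mul_star_S_mul_S]
    _ = F.S e := by rw [h2, F.S_mul_star_S_mul_S]

theorem P_mul_S_of_ne (hE : E.RowFinite) {v : V} {e : W} (h : v ≠ E.r e) :
    F.P v * F.S e = 0 := by
  rw [← F.P_mul_S hE, ← mul_assoc, F.P_mul_P _ _ h, zero_mul]

theorem star_S_mul_P (hE : E.RowFinite) (e : W) : star (F.S e) * F.P (E.r e) = star (F.S e) := by
  rw [← F.star_P, ← star_mul, F.P_mul_S hE]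

theorem star_S_mul_S (hE : E.RowFinite) {e f : W} (h : e ≠ f) : star (F.S e) * F.S f = 0 := by
  -- the range projections of edges with the same range sum to a vertex projection
  by_cases hr : E.r e = E.r f
  · have h1 := mul_eq_zero_of_projections (q := fun e => F.S e * star (F.S e))
      (fun i _ => F.projection_S_mul_star_S i) (F.star_P _) (F.P_mul_self _)
      (F.P_eq_sum (E.r e) (hE _) ⟨e, rfl⟩) (i := e) (j := f) (by simp) (by simp [hr]) h
    calc star (F.S e) * F.S f
        = star (F.S e) * (F.S e * star (F.S e) * (F.S f * star (F.S f))) * F.S f := by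
          have h2 := congrArg star (F.S_mul_star_S_mul_S e)
          simp only [star_mul, star_star] at h2
          rw [← mul_assoc (star (F.S e)), h2, mul_assoc, F.S_mul_star_S_mul_S]
      _ = 0 := by rw [h1, mul_zero, zero_mul]
  · rw [← F.star_S_mul_P hE, mul_assoc, F.P_mul_S_of_ne hE hr, mul_zero]

/-- The element `s_μ` attached to the list of edges `l` followed by the vertex `v`, namely
`s_{e₁} ⋯ s_{eₙ} p_v`. It is zero unless `l` is a path with source `v`. -/
def path : List W → V → B
  | [], v => F.P v
  | e :: l, v => F.S e * path l v

@[simp] theorem path_nil (v : V) : F.path [] v = F.P v := rfl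
@[simp] theorem path_cons (e : W) (l : List W) (v : V) :
    F.path (e :: l) v = F.S e * F.path l v := rfl

theorem path_mul_P (l : List W) (v : V) : F.path l v * F.P v = F.path l v := by
  induction l with
  | nil => exact F.P_mul_self v
  | cons e l ih => rw [path_cons, mul_assoc, ih]

theorem P_mul_star_path (l : List W) (v : V) : F.P v * star (F.path l v) = star (F.path l v) := by
  rw [← F.star_P, ← star_mul, path_mul_P]

theorem path_mul_P_of_ne (l : List W) {v w : V} (h : v ≠ w) : F.path l v * F.P w = 0 := by
  rw [← path_mul_P, mul_assoc, F.P_mul_P _ _ h, mul_zero]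

theorem P_mul_path (hE : E.RowFinite) (l : List W) (v : V) :
    F.P (E.rangeOf l v) * F.path l v = F.path l v := by
  cases l with
  | nil => exact F.P_mul_self v
  | cons e l => rw [path_cons, ← mul_assoc, rangeOf_cons, F.P_mul_S hE]

theorem P_mul_path_of_ne (hE : E.RowFinite) {w : V} (l : List W) (v : V) (h : w ≠ E.rangeOf l v) :
    F.P w * F.path l v = 0 := by
  rw [← P_mul_path F hE, ← mul_assoc, F.P_mul_P _ _ h, zero_mul]

theorem path_eq_zero (hE : E.RowFinite) {l : List W} {v : V} (h : ¬ E.IsPath l v) :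
    F.path l v = 0 := by
  induction l with
  | nil => simp at h
  | cons e l ih =>
    rw [isPath_cons, not_and_or] at h
    rcases h with h | h
    · rw [path_cons, ← F.S_mul_P, mul_assoc, P_mul_path_of_ne F hE l v h, mul_zero]
    · rw [path_cons, ih h, mul_zero]

theorem path_append (hE : E.RowFinite) (μ α : List W) (v : V) :
    F.path (μ ++ α) v = F.path μ (E.rangeOf α v) * F.path α v := by
  induction μ with
  | nil => exact (P_mul_path F hE α v).symm
  | cons e μ ih => rw [List.cons_append, path_cons, ih, path_cons, mul_assoc]

theorem star_path_cons_mul_path_cons (hE : E.RowFinite) (e : W) (l : List W) (v : V) (l' : List W)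
    (v' : V) (h : E.IsPath (e :: l) v) :
    star (F.path (e :: l) v) * F.path (e :: l') v' = star (F.path l v) * F.path l' v' := by
  have h1 : star (F.path l v) * F.P (E.s e) = star (F.path l v) := by
    rw [← F.star_P, ← star_mul, h.1, P_mul_path F hE]
  rw [path_cons, path_cons, star_mul, mul_assoc, ← mul_assoc (star (F.S e)), F.star_S_mul_self,
    ← mul_assoc, h1]

theorem star_path_cons_mul_path_cons_of_ne (hE : E.RowFinite) {e f : W} (h : e ≠ f) (l : List W)
    (v : V) (l' : List W) (v' : V) :
    star (F.path (e :: l) v) * F.path (f :: l') v' = 0 := by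
  rw [path_cons, path_cons, star_mul, mul_assoc, ← mul_assoc (star (F.S e)), F.star_S_mul_S hE h,
    zero_mul, mul_zero]

theorem star_path_mul_path_self (hE : E.RowFinite) {l : List W} {v : V} (h : E.IsPath l v) :
    star (F.path l v) * F.path l v = F.P v := by
  induction l with
  | nil => rw [path_nil, F.star_P, F.P_mul_self]
  | cons e l ih => rw [star_path_cons_mul_path_cons F hE e l v l v h, ih h.2]

theorem star_path_mul_path_append (hE : E.RowFinite) {μ : List W} (α : List W) {v : V} (w : V)
    (h : E.IsPath μ v) (hr : E.rangeOf α w = v) :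
    star (F.path μ v) * F.path (μ ++ α) w = F.path α w := by
  rw [path_append F hE, hr, ← mul_assoc, star_path_mul_path_self F hE h, ← hr, P_mul_path F hE]

theorem star_path_append_mul_path (hE : E.RowFinite) {μ : List W} (α : List W) {v : V} (w : V)
    (h : E.IsPath μ v) (hr : E.rangeOf α w = v) :
    star (F.path (μ ++ α) w) * F.path μ v = star (F.path α w) := by
  rw [← star_path_mul_path_append F hE α w h hr, star_mul, star_star]

/-- Two paths neither of which extends the other have orthogonal ranges. -/
theorem star_path_mul_path_of_not_prefix (hE : E.RowFinite) {μ ν : List W} (v w : V)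
    (h1 : ¬ μ <+: ν) (h2 : ¬ ν <+: μ) : star (F.path μ v) * F.path ν w = 0 := by
  induction μ generalizing ν with
  | nil => simp at h1
  | cons e μ ih =>
    cases ν with
    | nil => simp at h2
    | cons f ν =>
      by_cases hef : e = f
      · subst hef
        by_cases hp : E.IsPath (e :: μ) v
        · rw [star_path_cons_mul_path_cons F hE _ _ _ _ _ hp]
          exact ih (fun h => h1 (by simpa using h)) (fun h => h2 (by simpa using h))
        · rw [F.path_eq_zero hE hp, star_zero, zero_mul]
      · exact star_path_cons_mul_path_cons_of_ne F hE hef _ _ _ _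

theorem star_path_mul_path_of_ne_vertex (hE : E.RowFinite) (α : List W) {v w : V} (μ : List W)
    (hr : E.rangeOf α w ≠ v) : star (F.path μ v) * F.path (μ ++ α) w = 0 := by
  by_cases h : E.IsPath μ v
  · rw [path_append F hE]
    by_cases h' : E.IsPath μ (E.rangeOf α w)
    · cases μ with
      | nil => rw [← mul_assoc, path_nil, path_nil, F.star_P, F.P_mul_P _ _ hr.symm, zero_mul]
      | cons e μ => exact absurd (h'.source_unique h) hr
    · rw [F.path_eq_zero hE h', zero_mul, mul_zero]
  · rw [F.path_eq_zero hE h, star_zero, zero_mul]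

end CKFamily
end DirectedGraph

/-! ### The universal property -/

namespace DirectedGraph

variable {V W : Type*} {E : DirectedGraph V W}

namespace CStarAlg

theorem of_eq_zero {a : E.FreeStarAlg} (h : E.CKRelation a) : of E a = 0 := by
  rw [← norm_eq_zero, LinearIsometry.norm_map, FreeStarAlg.norm_def]
  exact E.isCKSeminorm_univSeminorm.relation a h

variable (E) in
/-- The universal Cuntz-Krieger family in `C*(E)`. -/
def univ : E.CKFamily E.CStarAlg where
  P := p E
  S := s E
  star_P v := by rw [p, ← of_star, FreeStarAlg.star_p]
  P_mul_self v := by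
    rw [p, ← of_mul, ← sub_eq_zero, ← map_sub]
    exact of_eq_zero (.proj v)
  P_mul_P v w h := by
    rw [p, p, ← of_mul]
    exact of_eq_zero (.orth v w h)
  star_S_mul_self e := by
    rw [p, s, ← of_star, ← of_mul, ← sub_eq_zero, ← map_sub]
    exact of_eq_zero (.source e)
  P_eq_sum v hfin hne := by
    have h := of_eq_zero (.range v hfin hne)
    rw [map_sub, map_sum, sub_eq_zero] at h
    refine h.trans (Finset.sum_congr rfl fun e _ => ?_)
    rw [of_mul, of_star, s]

end CStarAlg

namespace CKFamily

variable {B : Type*} [NonUnitalCStarAlgebra B] (F : E.CKFamily B)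

/-- The value of a letter in a Cuntz-Krieger family. -/
def letter : GraphLetter V W → B
  | .vert v => F.P v
  | .edge e => F.S e
  | .edgeStar e => star (F.S e)

theorem letter_conj (x : GraphLetter V W) : F.letter x.conj = star (F.letter x) := by
  cases x <;> simp [GraphLetter.conj, letter, F.star_P]

/-- The homomorphism from the free `*`-algebra which is given by a Cuntz-Krieger family. -/
def freeHom : E.FreeStarAlg →ₙₐ[ℂ] B :=
  MonoidAlgebra.liftMagma ℂ (FreeSemigroup.lift F.letter)

theorem freeHom_single (w : FreeSemigroup (GraphLetter V W)) (c : ℂ) :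
    F.freeHom (MonoidAlgebra.single w c : MonoidAlgebra ℂ _) = c • FreeSemigroup.lift F.letter w :=
  (MonoidAlgebra.liftMagma_apply_apply ..).trans (by simp)

theorem freeHom_word (w : FreeSemigroup (GraphLetter V W)) :
    F.freeHom (FreeStarAlg.word E w) = FreeSemigroup.lift F.letter w :=
  (F.freeHom_single w 1).trans (one_smul _ _)

theorem freeHom_p (v : V) : F.freeHom (FreeStarAlg.p E v) = F.P v := by
  rw [FreeStarAlg.p, freeHom_word, FreeSemigroup.lift_of, letter]

theorem freeHom_s (e : W) : F.freeHom (FreeStarAlg.s E e) = F.S e := by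
  rw [FreeStarAlg.s, freeHom_word, FreeSemigroup.lift_of, letter]

theorem lift_star (w : FreeSemigroup (GraphLetter V W)) :
    FreeSemigroup.lift F.letter (star w) = star (FreeSemigroup.lift F.letter w) := by
  induction w using FreeSemigroup.recOnMul with
  | ih1 x =>
    have : star (FreeSemigroup.of x) = FreeSemigroup.of x.conj := rfl
    rw [this, FreeSemigroup.lift_of, FreeSemigroup.lift_of, letter_conj]
  | ih2 x y hx hy => rw [star_mul, map_mul, map_mul, star_mul, hx, hy]

theorem freeHom_star (a : E.FreeStarAlg) : F.freeHom (star a) = star (F.freeHom a) := by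
  induction a using MonoidAlgebra.induction_linear with
  | zero => exact (congrArg _ (star_zero (E.FreeStarAlg))).trans (by
      rw [show (F.freeHom 0 : B) = 0 from map_zero F.freeHom]
      exact ((congrArg star (map_zero F.freeHom)).trans (star_zero B)).symm)
  | add f g hf hg =>
    refine (congrArg F.freeHom (star_add (R := E.FreeStarAlg) f g)).trans ?_
    refine (map_add F.freeHom _ _).trans ?_
    rw [hf, hg, ← star_add]
    exact congrArg star (map_add F.freeHom _ _).symm
  | single w c =>
    refine (congrArg F.freeHom (MonoidAlgebra.star_single_semigroup w c)).trans ?_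
    rw [freeHom_single, freeHom_single, lift_star, star_smul]

/-- The `C*`-seminorm on the free `*`-algebra which is given by a Cuntz-Krieger family. -/
def seminorm : Seminorm ℂ E.FreeStarAlg :=
  (normSeminorm ℂ B).comp (F.freeHom : E.FreeStarAlg →ₗ[ℂ] B)

theorem seminorm_apply (a : E.FreeStarAlg) : F.seminorm a = ‖F.freeHom a‖ := rfl

theorem isCKSeminorm : E.IsCKSeminorm F.seminorm where
  mul_le a b := by
    rw [seminorm_apply, map_mul]
    exact norm_mul_le _ _
  star_mul_self a := by
    rw [seminorm_apply, map_mul, freeHom_star, CStarRing.norm_star_mul_self, sq]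
    rfl
  relation a ha := by
    rw [seminorm_apply, norm_eq_zero]
    induction ha with
    | proj v => rw [map_sub, map_mul, freeHom_p, F.P_mul_self, sub_self]
    | orth v w h => rw [map_mul, freeHom_p, freeHom_p, F.P_mul_P _ _ h]
    | source e =>
      rw [map_sub, map_mul, freeHom_star, freeHom_s, freeHom_p, F.star_S_mul_self, sub_self]
    | range v hfin hne =>
      rw [map_sub, freeHom_p, map_sum, F.P_eq_sum v hfin hne, sub_eq_zero]
      refine Finset.sum_congr rfl fun e _ => ?_
      rw [map_mul, freeHom_star, freeHom_s]

theorem norm_freeHom_le (a : E.FreeStarAlg) : ‖F.freeHom a‖ ≤ ‖a‖ :=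
  E.le_univNorm F.isCKSeminorm a

/-- The extension to `C*(E)` of the homomorphism given by a Cuntz-Krieger family, as a continuous
linear map. -/
def liftCLM : E.CStarAlg →L[ℂ] B :=
  ((F.freeHom : E.FreeStarAlg →ₗ[ℂ] B).mkContinuous 1
    (fun a => by simpa using F.norm_freeHom_le a)).extend (CStarAlg.of E).toContinuousLinearMap

theorem liftCLM_of (a : E.FreeStarAlg) : F.liftCLM (CStarAlg.of E a) = F.freeHom a :=
  ContinuousLinearMap.extend_eq _ (e := (CStarAlg.of E).toContinuousLinearMap)
    (CStarAlg.isDenseInducing_of E).dense (CStarAlg.of E).isometry.isUniformInducing a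

/-- The universal property of `C*(E)`: the homomorphism given by a Cuntz-Krieger family. -/
def lift : E.CStarAlg →⋆ₙₐ[ℂ] B where
  __ := F.liftCLM
  map_zero' := map_zero F.liftCLM
  map_mul' x y := by
    change F.liftCLM (x * y) = F.liftCLM x * F.liftCLM y
    refine CStarAlg.induction_on₂ x y (isClosed_eq (by fun_prop) (by fun_prop)) fun a b => ?_
    rw [← CStarAlg.of_mul, liftCLM_of, liftCLM_of, liftCLM_of, map_mul]
  map_star' x := by
    change F.liftCLM (star x) = star (F.liftCLM x)
    refine CStarAlg.induction_on x (isClosed_eq (by fun_prop) (by fun_prop)) fun a => ?_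
    rw [← CStarAlg.of_star, liftCLM_of, liftCLM_of, freeHom_star]

theorem lift_p (v : V) : F.lift (CStarAlg.p E v) = F.P v := (F.liftCLM_of _).trans (F.freeHom_p v)

theorem lift_s (e : W) : F.lift (CStarAlg.s E e) = F.S e := (F.liftCLM_of _).trans (F.freeHom_s e)

theorem lift_path (l : List W) (v : V) : F.lift ((CStarAlg.univ E).path l v) = F.path l v := by
  induction l with
  | nil => exact F.lift_p v
  | cons e l ih => rw [path_cons, map_mul, ih, path_cons]; exact congrArg (· * _) (F.lift_s e)

end CKFamily

/-! ### The monomials `s_μ s_ν^*` -/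

namespace CStarAlg

/-- The span of the elements `s_μ s_ν^*`. -/
def monomialSpan (E : DirectedGraph V W) : Submodule ℂ E.CStarAlg :=
  Submodule.span ℂ {x | ∃ μ ν v, x = (univ E).path μ v * star ((univ E).path ν v)}

theorem path_mul_star_path_mem (μ ν : List W) (v : V) :
    (univ E).path μ v * star ((univ E).path ν v) ∈ monomialSpan E :=
  Submodule.subset_span ⟨μ, ν, v, rfl⟩

/-- The span of the monomials is stable under multiplication by the generators. -/
theorem letter_mul_mem (hE : E.RowFinite) (x : GraphLetter V W) {a : E.CStarAlg}
    (ha : a ∈ monomialSpan E) : (univ E).letter x * a ∈ monomialSpan E := by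
  induction ha using Submodule.span_induction with
  | zero => rw [mul_zero]; exact zero_mem _
  | add a b _ _ ha hb => rw [mul_add]; exact add_mem ha hb
  | smul c a _ ha => rw [mul_smul_comm]; exact Submodule.smul_mem _ c ha
  | mem a ha =>
    obtain ⟨μ, ν, v, rfl⟩ := ha
    rw [← mul_assoc]
    cases x with
    | vert w =>
      by_cases hw : w = E.rangeOf μ v
      · rw [CKFamily.letter, hw, CKFamily.P_mul_path _ hE]
        exact path_mul_star_path_mem μ ν v
      · rw [CKFamily.letter, CKFamily.P_mul_path_of_ne _ hE μ v hw, zero_mul]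
        exact zero_mem _
    | edge e => exact path_mul_star_path_mem (e :: μ) ν v
    | edgeStar e =>
      cases μ with
      | nil =>
        by_cases hv : v = E.r e
        · have h : (univ E).letter (.edgeStar e) * (univ E).path [] v * star ((univ E).path ν v)
              = (univ E).path [] (E.s e) * star ((univ E).path (ν ++ [e]) (E.s e)) := by
            rw [CKFamily.path_append _ hE, CKFamily.letter, CKFamily.path_nil, CKFamily.path_nil,
              hv, CKFamily.star_S_mul_P _ hE, star_mul, ← mul_assoc, CKFamily.P_mul_star_path,
              CKFamily.path_cons, CKFamily.path_nil, CKFamily.S_mul_P]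
            rfl
          rw [h]
          exact path_mul_star_path_mem _ _ _
        · rw [CKFamily.letter, CKFamily.path_nil, ← CKFamily.star_S_mul_P _ hE, mul_assoc (star _),
            CKFamily.P_mul_P _ _ _ (Ne.symm hv), mul_zero, zero_mul]
          exact zero_mem _
      | cons f μ =>
        by_cases hp : E.IsPath (f :: μ) v
        · by_cases hef : e = f
          · subst hef
            have h : (univ E).letter (.edgeStar e) * (univ E).path (e :: μ) v
                = (univ E).path μ v := by
              rw [CKFamily.letter, CKFamily.path_cons, ← mul_assoc, CKFamily.star_S_mul_self, hp.1,
                CKFamily.P_mul_path _ hE]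
            rw [h]
            exact path_mul_star_path_mem _ _ _
          · rw [CKFamily.letter, CKFamily.path_cons, ← mul_assoc, CKFamily.star_S_mul_S _ hE hef,
              zero_mul, zero_mul]
            exact zero_mem _
        · rw [CKFamily.path_eq_zero _ hE hp, mul_zero, zero_mul]
          exact zero_mem _

theorem letter_mem (hE : E.RowFinite) (x : GraphLetter V W) :
    (univ E).letter x ∈ monomialSpan E := by
  have h : ∀ v, (univ E).P v ∈ monomialSpan E := fun v => by
    have := path_mul_star_path_mem (E := E) [] [] v
    rwa [CKFamily.path_nil, CKFamily.star_P, CKFamily.P_mul_self] at this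
  cases x with
  | vert v => exact h v
  | edge e =>
    have := letter_mul_mem hE (.edge e) (h (E.s e))
    rwa [CKFamily.letter, CKFamily.S_mul_P] at this
  | edgeStar e =>
    have := letter_mul_mem hE (.edgeStar e) (h (E.r e))
    rwa [CKFamily.letter, CKFamily.star_S_mul_P _ hE] at this

theorem of_word (w : FreeSemigroup (GraphLetter V W)) :
    of E (FreeStarAlg.word E w) = FreeSemigroup.lift (univ E).letter w := by
  induction w using FreeSemigroup.recOnMul with
  | ih1 x =>
    rw [FreeSemigroup.lift_of]
    cases x with
    | vert v => rfl
    | edge e => rfl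
    | edgeStar e =>
      have h : FreeStarAlg.word E (FreeSemigroup.of (.edgeStar e)) = star (FreeStarAlg.s E e) :=
        (FreeStarAlg.star_word E (FreeSemigroup.of (.edge e))).symm
      rw [h, of_star]
      rfl
  | ih2 x y hx hy => rw [FreeStarAlg.word_mul, of_mul, hx, hy, map_mul]

theorem lift_letter_mul_mem (hE : E.RowFinite) (w : FreeSemigroup (GraphLetter V W))
    {a : E.CStarAlg} (ha : a ∈ monomialSpan E) :
    FreeSemigroup.lift (univ E).letter w * a ∈ monomialSpan E := by
  induction w using FreeSemigroup.recOnMul generalizing a with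
  | ih1 x => rw [FreeSemigroup.lift_of]; exact letter_mul_mem hE x ha
  | ih2 x y hx hy => rw [map_mul, mul_assoc]; exact letter_mul_mem hE x (hy ha)

theorem of_mem_monomialSpan (hE : E.RowFinite) (a : E.FreeStarAlg) : of E a ∈ monomialSpan E := by
  induction a using MonoidAlgebra.induction_linear with
  | zero => exact (congrArg (· ∈ monomialSpan E) (map_zero (of E))).mpr (zero_mem _)
  | add f g hf hg =>
    exact (congrArg (· ∈ monomialSpan E) (map_add (of E) f g)).mpr (add_mem hf hg)
  | single w c =>
    have h : (MonoidAlgebra.single w c : MonoidAlgebra ℂ (FreeSemigroup (GraphLetter V W)))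
        = c • (MonoidAlgebra.single w 1 : MonoidAlgebra ℂ (FreeSemigroup (GraphLetter V W))) := by
      simp [MonoidAlgebra.smul_single]
    rw [h]
    refine (congrArg (· ∈ monomialSpan E) (map_smul (of E) c (FreeStarAlg.word E w))).mpr
      (Submodule.smul_mem _ c ?_)
    rw [of_word]
    clear h
    induction w using FreeSemigroup.recOnMul with
    | ih1 x => rw [FreeSemigroup.lift_of]; exact letter_mem hE x
    | ih2 x y hx hy => rw [map_mul]; exact lift_letter_mul_mem hE _ hy

/-- The monomials `s_μ s_ν^*` have dense span. -/
theorem dense_monomialSpan (hE : E.RowFinite) : Dense (monomialSpan E : Set E.CStarAlg) :=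
  (isDenseInducing_of E).dense.mono (by rintro _ ⟨a, rfl⟩; exact of_mem_monomialSpan hE a)

/-- A closed condition which is linear holds on `C*(E)` as soon as it holds for the monomials. -/
theorem monomial_induction (hE : E.RowFinite) (K : Submodule ℂ E.CStarAlg)
    (hK : IsClosed (K : Set E.CStarAlg))
    (h : ∀ μ ν v, E.IsPath μ v → E.IsPath ν v →
      (univ E).path μ v * star ((univ E).path ν v) ∈ K) (a : E.CStarAlg) : a ∈ K := by
  have h1 : monomialSpan E ≤ K := by
    refine Submodule.span_le.2 ?_
    rintro _ ⟨μ, ν, v, rfl⟩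
    by_cases hμ : E.IsPath μ v
    · by_cases hν : E.IsPath ν v
      · exact h μ ν v hμ hν
      · rw [CKFamily.path_eq_zero _ hE hν, star_zero, mul_zero]; exact zero_mem _
    · rw [CKFamily.path_eq_zero _ hE hμ, zero_mul]; exact zero_mem _
  exact hK.closure_subset_iff.2 h1 (dense_monomialSpan hE a)

end CStarAlg
end DirectedGraph

/-! ### Partial permutation operators -/

section PartialPermutation

open scoped ENNReal lp ComplexConjugate

variable {X : Type*}

theorem sum_norm_sq_pequiv_le (φ : X ≃. X) (f : ℓ²(X, ℂ)) (t : Finset X) :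
    ∑ y ∈ t, ‖((φ.symm y).elim 0 fun x => f x : ℂ)‖ ^ (2 : ℝ≥0∞).toReal
      ≤ ‖f‖ ^ (2 : ℝ≥0∞).toReal := by
  classical
  have h0 : ((0 : ℝ)) ^ (2 : ℝ≥0∞).toReal = 0 := by simp
  set t' := t.filter fun y => (φ.symm y).isSome with ht'
  have h1 : ∑ y ∈ t, ‖((φ.symm y).elim 0 fun x => f x : ℂ)‖ ^ (2 : ℝ≥0∞).toReal
      = ∑ y ∈ t', ‖((φ.symm y).elim 0 fun x => f x : ℂ)‖ ^ (2 : ℝ≥0∞).toReal := by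
    refine (Finset.sum_filter_of_ne fun y _ hy => ?_).symm
    by_contra hn
    rw [Option.not_isSome_iff_eq_none] at hn
    rw [hn] at hy
    simp at hy
  let g : {y // y ∈ t'} → X := fun y => (φ.symm y.1).get (Finset.mem_filter.1 y.2).2
  have hg : Function.Injective g := by
    intro y z hyz
    have hy : φ.symm y.1 = some (g y) := by simp [g]
    have hz : φ.symm z.1 = some (g z) := by simp [g]
    rw [← hyz, PEquiv.eq_some_iff] at hz
    rw [PEquiv.eq_some_iff] at hy
    exact Subtype.ext (Option.some.inj (hy.symm.trans hz))
  rw [h1, ← Finset.sum_attach]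
  have h2 : ∀ y ∈ t'.attach, ‖((φ.symm y.1).elim 0 fun x => f x : ℂ)‖ ^ (2 : ℝ≥0∞).toReal
      = ‖f (g y)‖ ^ (2 : ℝ≥0∞).toReal := by
    intro y _
    have hy : φ.symm y.1 = some (g y) := by simp [g]
    rw [hy]
    rfl
  rw [Finset.sum_congr rfl h2]
  have h3 := lp.sum_rpow_le_norm_rpow (p := 2) (by simp) f (t'.attach.map ⟨g, hg⟩)
  rwa [Finset.sum_map] at h3

/-- The partial isometry of `ℓ²(X)` which sends the basis vector at `x` to the basis vector at
`φ x`, or to `0` if `φ` is not defined at `x`. -/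
def permOp (φ : X ≃. X) : ℓ²(X, ℂ) →L[ℂ] ℓ²(X, ℂ) :=
  LinearMap.mkContinuous
    { toFun := fun f => ⟨fun y => (φ.symm y).elim 0 fun x => f x,
        memℓp_gen' fun t => sum_norm_sq_pequiv_le φ f t⟩
      map_add' := fun f g => by
        ext y
        change ((φ.symm y).elim 0 fun x => f x + g x : ℂ)
          = (φ.symm y).elim 0 _ + (φ.symm y).elim 0 _
        cases φ.symm y <;> simp
      map_smul' := fun c f => by
        ext y
        change ((φ.symm y).elim 0 fun x => c * f x : ℂ) = c * (φ.symm y).elim 0 _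
        cases φ.symm y <;> simp } 1
    (fun f => by
      rw [one_mul]
      exact lp.norm_le_of_forall_sum_le (by simp) (norm_nonneg _)
        fun t => sum_norm_sq_pequiv_le φ f t)

theorem permOp_apply (φ : X ≃. X) (f : ℓ²(X, ℂ)) (y : X) :
    permOp φ f y = (φ.symm y).elim 0 fun x => f x := rfl

theorem permOp_mul (φ ψ : X ≃. X) : permOp φ * permOp ψ = permOp (ψ.trans φ) := by
  ext f y
  change permOp φ (permOp ψ f) y = _
  rw [permOp_apply, permOp_apply, PEquiv.symm_trans_rev]
  change _ = Option.elim ((φ.symm y).bind ψ.symm) 0 _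
  cases φ.symm y <;> simp [permOp_apply]

open scoped Classical in
theorem permOp_inner (φ : X ≃. X) (x y : X) :
    inner ℂ (lp.single 2 y (1 : ℂ)) (permOp φ (lp.single 2 x (1 : ℂ)) : ℓ²(X, ℂ))
      = if φ x = some y then 1 else 0 := by
  rw [lp.inner_single_left, permOp_apply]
  by_cases h : φ x = some y
  · rw [if_pos h, (PEquiv.eq_some_iff φ).2 h]
    simp
  · rw [if_neg h]
    cases h' : φ.symm y with
    | none => simp
    | some z =>
      have hz : z ≠ x := by
        rintro rfl
        exact h ((PEquiv.eq_some_iff φ).1 h')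
      simp [lp.single_apply, hz]

open scoped Classical in
/-- An operator on `ℓ²(X)` is determined by its action on the basis vectors. -/
theorem clm_ext_single {S T : ℓ²(X, ℂ) →L[ℂ] ℓ²(X, ℂ)}
    (h : ∀ x, S (lp.single 2 x (1 : ℂ)) = T (lp.single 2 x (1 : ℂ))) : S = T := by
  ext1 f
  have hf := lp.hasSum_single (p := 2) (by simp) f
  have h1 := hf.mapL S
  have h2 := hf.mapL T
  have h3 : ∀ x, S (lp.single 2 x (f x)) = T (lp.single 2 x (f x)) := by
    intro x
    have : (lp.single 2 x (f x) : ℓ²(X, ℂ)) = f x • lp.single 2 x (1 : ℂ) := by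
      rw [← lp.single_smul, smul_eq_mul, mul_one]
    rw [this, map_smul, map_smul, h]
  exact h1.unique (by simpa only [h3] using h2)

theorem star_permOp (φ : X ≃. X) : star (permOp φ) = permOp φ.symm := by
  classical
  refine clm_ext_single fun x => ?_
  ext y
  have h : ∀ f : ℓ²(X, ℂ), f y = inner ℂ (lp.single 2 y (1 : ℂ)) f := fun f => by
    rw [lp.inner_single_left]
    simp
  rw [h, h, ContinuousLinearMap.star_eq_adjoint, ContinuousLinearMap.adjoint_inner_right,
    ← inner_conj_symm, permOp_inner, permOp_inner]
  simp [PEquiv.eq_some_iff]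

end PartialPermutation

/-! ### The boundary path representation -/

namespace DirectedGraph

variable {V W : Type*} (E : DirectedGraph V W)

/-- The range of a letter of a boundary path. -/
def letterRange : W ⊕ V → V := Sum.elim E.r id

/-- The source of a letter of a boundary path. -/
def letterSource : W ⊕ V → V := Sum.elim E.s id

/-- A boundary path: an infinite path, or a finite path which starts at a source of the graph. A
finite path is made infinite by repeating forever the letter `inr v`, where `v` is the source of the
graph at which the path starts; this letter may be thought of as a loop at `v`. -/
@[ext]
structure BoundaryPath where
  /-- the sequence of letters -/
  letter : ℕ → W ⊕ V
  chain : ∀ i, E.letterRange (letter (i + 1)) = E.letterSource (letter i)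
  source : ∀ i v, letter i = Sum.inr v → ∀ e, E.r e ≠ v

variable {E}

namespace BoundaryPath

/-- The range of a boundary path. -/
def range (x : E.BoundaryPath) : V := E.letterRange (x.letter 0)

/-- The boundary path without its first letter. -/
def tail (x : E.BoundaryPath) : E.BoundaryPath where
  letter i := x.letter (i + 1)
  chain i := x.chain (i + 1)
  source i := x.source (i + 1)

/-- The boundary path `x` preceded by the edge `e`. -/
def cons (e : W) (x : E.BoundaryPath) (h : E.s e = x.range) : E.BoundaryPath where
  letter i := Nat.casesOn i (Sum.inl e) x.letter
  chain i := by cases i with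
    | zero => exact h.symm
    | succ i => exact x.chain i
  source i := by cases i with
    | zero => rintro v ⟨⟩
    | succ i => exact x.source i

theorem range_tail {x : E.BoundaryPath} {e : W} (h : x.letter 0 = Sum.inl e) :
    E.s e = x.tail.range := by
  have := x.chain 0
  rw [h] at this
  exact this.symm

theorem cons_tail {x : E.BoundaryPath} {e : W} (h : x.letter 0 = Sum.inl e) :
    cons e x.tail (range_tail h) = x := by
  ext i
  cases i with
  | zero => exact h.symm
  | succ i => rfl

open scoped Classical in
/-- A letter with range `v`: an edge, if there is one. -/
def nextLetter (E : DirectedGraph V W) (v : V) : W ⊕ V :=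
  if h : ∃ e, E.r e = v then Sum.inl h.choose else Sum.inr v

theorem letterRange_nextLetter (v : V) : E.letterRange (nextLetter E v) = v := by
  unfold nextLetter
  split_ifs with h
  · exact h.choose_spec
  · rfl

/-- Every vertex is the range of a boundary path. -/
theorem exists_range_eq (v : V) : ∃ x : E.BoundaryPath, x.range = v := by
  let y : ℕ → V := fun i => (fun v => E.letterSource (nextLetter E v))^[i] v
  refine ⟨⟨fun i => nextLetter E (y i), fun i => ?_, fun i w h => ?_⟩, letterRange_nextLetter _⟩
  · rw [letterRange_nextLetter]
    exact Function.iterate_succ_apply' _ _ _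
  · unfold nextLetter at h
    split_ifs at h with h'
    rw [Sum.inr.injEq] at h
    subst h
    exact fun e he => h' ⟨e, he⟩

open scoped Classical in
/-- The partial bijection `x ↦ e x`. -/
def consEquiv (e : W) : E.BoundaryPath ≃. E.BoundaryPath where
  toFun x := if h : E.s e = x.range then some (cons e x h) else none
  invFun x := if x.letter 0 = Sum.inl e then some x.tail else none
  inv x y := by
    change (if _ then _ else _) = some _ ↔ (dite _ _ _) = some _
    constructor
    · split_ifs with h h1 h1
      · rintro ⟨⟩
        exact congrArg some (cons_tail h)
      · rintro ⟨⟩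
        exact absurd (range_tail h) h1
      · rintro ⟨⟩
      · rintro ⟨⟩
    · split_ifs with h h1 h1
      · rintro ⟨⟩
        rfl
      · rintro ⟨⟩
        exact absurd rfl h1
      · rintro ⟨⟩
      · rintro ⟨⟩

open scoped Classical in
theorem consEquiv_apply (e : W) (x : E.BoundaryPath) :
    consEquiv e x = if h : E.s e = x.range then some (cons e x h) else none := rfl

open scoped Classical in
theorem consEquiv_symm_apply (e : W) (x : E.BoundaryPath) :
    (consEquiv e).symm x = if x.letter 0 = Sum.inl e then some x.tail else none := rfl

open scoped Classical in
/-- The identity on the boundary paths with range `v`. -/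
def vertexEquiv (v : V) : E.BoundaryPath ≃. E.BoundaryPath := PEquiv.ofSet {x | x.range = v}

end BoundaryPath

open BoundaryPath
open scoped lp

open scoped Classical in
theorem permOp_vertexEquiv_apply (v : V) (f : ℓ²(E.BoundaryPath, ℂ)) (y : E.BoundaryPath) :
    permOp (vertexEquiv v) f y = if y.range = v then f y else 0 := by
  rw [permOp_apply, vertexEquiv, PEquiv.ofSet_symm]
  change Option.elim (if y.range = v then some y else none) _ _ = _
  split_ifs <;> rfl

open scoped Classical in
theorem permOp_consEquiv_apply (e : W) (f : ℓ²(E.BoundaryPath, ℂ)) (y : E.BoundaryPath) :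
    permOp (consEquiv e) f y = if y.letter 0 = Sum.inl e then f y.tail else 0 := by
  rw [permOp_apply, consEquiv_symm_apply]
  split_ifs <;> rfl

open scoped Classical in
theorem permOp_consEquiv_symm_apply (e : W) (f : ℓ²(E.BoundaryPath, ℂ)) (y : E.BoundaryPath) :
    permOp (consEquiv e).symm f y = if h : E.s e = y.range then f (cons e y h) else 0 := by
  rw [permOp_apply, PEquiv.symm_symm, consEquiv_apply]
  split_ifs <;> rfl

open scoped Classical in
theorem permOp_consEquiv_mul_symm_apply (e : W) (f : ℓ²(E.BoundaryPath, ℂ)) (y : E.BoundaryPath) :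
    permOp (consEquiv e) (permOp (consEquiv e).symm f) y
      = if y.letter 0 = Sum.inl e then f y else 0 := by
  rw [permOp_consEquiv_apply]
  split_ifs with h
  · rw [permOp_consEquiv_symm_apply, dif_pos (range_tail h), cons_tail h]
  · rfl

variable (E) in
/-- The boundary path representation of a graph on `ℓ²` of its boundary paths. -/
def boundaryFamily : E.CKFamily (ℓ²(E.BoundaryPath, ℂ) →L[ℂ] ℓ²(E.BoundaryPath, ℂ)) where
  P v := permOp (vertexEquiv v)
  S e := permOp (consEquiv e)
  star_P v := by rw [star_permOp, vertexEquiv, PEquiv.ofSet_symm]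
  P_mul_self v := by
    ext f y
    change permOp (vertexEquiv v) (permOp (vertexEquiv v) f) y = _
    rw [permOp_vertexEquiv_apply, permOp_vertexEquiv_apply]
    split_ifs <;> rfl
  P_mul_P v w h := by
    ext f y
    change permOp (vertexEquiv v) (permOp (vertexEquiv w) f) y = 0
    rw [permOp_vertexEquiv_apply, permOp_vertexEquiv_apply]
    split_ifs with h1 h2
    · exact absurd (h1.symm.trans h2) h
    · rfl
    · rfl
  star_S_mul_self e := by
    rw [star_permOp]
    ext f y
    change permOp (consEquiv e).symm (permOp (consEquiv e) f) y = _
    rw [permOp_consEquiv_symm_apply, permOp_vertexEquiv_apply]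
    split_ifs with h1 h2 h2
    · exact (permOp_consEquiv_apply ..).trans (if_pos rfl)
    · exact absurd h1.symm h2
    · exact absurd h2.symm h1
    · rfl
  P_eq_sum v hfin hne := by
    classical
    ext f y
    have h : ∀ t : Finset W, (∑ e ∈ t, permOp (consEquiv e) * star (permOp (consEquiv e)) :
        ℓ²(E.BoundaryPath, ℂ) →L[ℂ] ℓ²(E.BoundaryPath, ℂ)) f y
        = ∑ e ∈ t, if y.letter 0 = Sum.inl e then f y else 0 := by
      intro t
      induction t using Finset.induction_on with
      | empty => rfl
      | insert e t he ih =>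
        rw [Finset.sum_insert he, Finset.sum_insert he, ← ih, ← permOp_consEquiv_mul_symm_apply,
          star_permOp]
        rfl
    rw [h, permOp_vertexEquiv_apply]
    cases hy : y.letter 0 with
    | inl e =>
      have hr : y.range = E.r e := by rw [BoundaryPath.range, hy]; rfl
      simp only [Sum.inl.injEq, Finset.sum_ite_eq, Set.Finite.mem_toFinset, Set.mem_ofPred_eq, hr]
    | inr w =>
      have hr : y.range = w := by rw [BoundaryPath.range, hy]; rfl
      have hw : y.range ≠ v := by
        rintro rfl
        obtain ⟨e, he⟩ := hne
        exact y.source 0 w hy e (he.trans hr)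
      simp [hw]

variable (E) in
/-- The boundary path representation of `C*(E)`. -/
def boundaryRep : E.CStarAlg →⋆ₙₐ[ℂ] (ℓ²(E.BoundaryPath, ℂ) →L[ℂ] ℓ²(E.BoundaryPath, ℂ)) :=
  (boundaryFamily E).lift

/-- The partial bijection `x ↦ μ x`, defined on the boundary paths whose range is the source `v` of
the path `μ`. -/
def pathEquiv : List W → V → E.BoundaryPath ≃. E.BoundaryPath
  | [], v => vertexEquiv v
  | e :: l, v => (pathEquiv l v).trans (consEquiv e)

theorem boundaryFamily_path (l : List W) (v : V) :
    (boundaryFamily E).path l v = permOp (pathEquiv l v) := by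
  induction l with
  | nil => rfl
  | cons e l ih => rw [CKFamily.path_cons, ih, pathEquiv, ← permOp_mul]; rfl

theorem boundaryFamily_P_ne_zero (v : V) : (boundaryFamily E).P v ≠ 0 := by
  classical
  obtain ⟨x, hx⟩ := BoundaryPath.exists_range_eq (E := E) v
  intro h
  have h1 := permOp_inner (vertexEquiv v) x x
  have h2 : vertexEquiv v x = some x := by
    rw [vertexEquiv]
    exact if_pos hx
  rw [if_pos h2] at h1
  change permOp (vertexEquiv v) = 0 at h
  simp [h] at h1

theorem CStarAlg.univ_P_ne_zero (v : V) : (CStarAlg.univ E).P v ≠ 0 := by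
  intro h
  apply boundaryFamily_P_ne_zero (E := E) v
  rw [← (boundaryFamily E).lift_p v]
  change (boundaryFamily E).lift ((CStarAlg.univ E).P v) = 0
  rw [h, map_zero]

/-- The boundary path `x` starts with the path `l` with source `v`. -/
def BoundaryPath.StartsWith : E.BoundaryPath → List W → V → Prop
  | x, [], v => x.range = v
  | x, e :: l, v => x.letter 0 = Sum.inl e ∧ StartsWith x.tail l v

theorem BoundaryPath.StartsWith.unique {x : E.BoundaryPath} {μ ν : List W} {v w : V}
    (hμ : x.StartsWith μ v) (hν : x.StartsWith ν w) (hl : μ.length = ν.length) :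
    μ = ν ∧ v = w := by
  induction μ generalizing x ν with
  | nil =>
    obtain rfl := List.length_eq_zero_iff.1 hl.symm
    exact ⟨rfl, hμ.symm.trans hν⟩
  | cons e μ ih =>
    cases ν with
    | nil => simp at hl
    | cons f ν =>
      obtain ⟨rfl, rfl⟩ := ih hμ.2 hν.2 (by simpa using hl)
      have := hμ.1.symm.trans hν.1
      rw [Sum.inl.injEq] at this
      exact ⟨by rw [this], rfl⟩

theorem startsWith_of_pathEquiv {l : List W} {v : V} {x y : E.BoundaryPath}
    (h : pathEquiv l v y = some x) : x.StartsWith l v := by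
  classical
  induction l generalizing x with
  | nil =>
    change (if y.range = v then some y else none) = some x at h
    split_ifs at h with h'
    cases h
    exact h'
  | cons e l ih =>
    change (pathEquiv l v y).bind (consEquiv e) = some x at h
    rw [Option.bind_eq_some_iff] at h
    obtain ⟨z, hz, hx⟩ := h
    rw [consEquiv_apply] at hx
    split_ifs at hx with h'
    cases hx
    exact ⟨rfl, ih hz⟩

theorem exists_pathEquiv_of_startsWith {l : List W} {v : V} {x : E.BoundaryPath}
    (h : x.StartsWith l v) : ∃ y, pathEquiv l v y = some x := by
  classical
  induction l generalizing x with
  | nil => exact ⟨x, if_pos h⟩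
  | cons e l ih =>
    obtain ⟨y, hy⟩ := ih h.2
    refine ⟨y, ?_⟩
    change (pathEquiv l v y).bind (consEquiv e) = some x
    rw [hy, Option.bind_some, consEquiv_apply, dif_pos (range_tail h.1), cons_tail h.1]

open scoped Classical in
/-- The diagonal coefficients of a monomial of degree zero in the boundary path representation. -/
theorem boundaryRep_monomial_diag {μ ν : List W} {v : V} (hl : μ.length = ν.length)
    (x : E.BoundaryPath) :
    inner ℂ (lp.single 2 x (1 : ℂ)) (boundaryRep E ((CStarAlg.univ E).path μ v *
      star ((CStarAlg.univ E).path ν v)) (lp.single 2 x (1 : ℂ)) : ℓ²(E.BoundaryPath, ℂ))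
      = if μ = ν ∧ x.StartsWith μ v then 1 else 0 := by
  rw [boundaryRep, map_mul, map_star, CKFamily.lift_path, CKFamily.lift_path, boundaryFamily_path,
    boundaryFamily_path, star_permOp, permOp_mul, permOp_inner]
  refine if_congr ⟨fun h => ?_, ?_⟩ rfl rfl
  · obtain ⟨y, hy, hx⟩ := Option.bind_eq_some_iff.1 h
    have h1 := startsWith_of_pathEquiv hx
    have h2 := startsWith_of_pathEquiv ((PEquiv.eq_some_iff _).1 hy)
    exact ⟨(h1.unique h2 hl).1, h1⟩
  · rintro ⟨rfl, h⟩
    obtain ⟨y, hy⟩ := exists_pathEquiv_of_startsWith h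
    exact Option.bind_eq_some_iff.2 ⟨y, (PEquiv.eq_some_iff _).2 hy, hy⟩

end DirectedGraph

/-! ### The gauge action and the expectation onto its fixed points -/

namespace DirectedGraph

variable {V W : Type*} {E : DirectedGraph V W}

namespace CStarAlg

variable (E) in
/-- The family `{p_v, z s_e}` for a complex number `z` of modulus one. -/
def gaugeFamily (z : Circle) : E.CKFamily E.CStarAlg where
  P := (univ E).P
  S e := (z : ℂ) • (univ E).S e
  star_P := (univ E).star_P
  P_mul_self := (univ E).P_mul_self
  P_mul_P := (univ E).P_mul_P
  star_S_mul_self e := by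
    rw [star_smul, smul_mul_smul_comm, (univ E).star_S_mul_self]
    simp [← Circle.coe_inv_eq_conj]
  P_eq_sum v hfin hne := by
    rw [(univ E).P_eq_sum v hfin hne]
    refine Finset.sum_congr rfl fun e _ => ?_
    rw [star_smul, smul_mul_smul_comm]
    simp [← Circle.coe_inv_eq_conj]

variable (E) in
/-- The gauge action of the circle on `C*(E)`. -/
def gauge (z : Circle) : E.CStarAlg →⋆ₙₐ[ℂ] E.CStarAlg := (gaugeFamily E z).lift

theorem gauge_path (z : Circle) (l : List W) (v : V) :
    gauge E z ((univ E).path l v) = (z : ℂ) ^ l.length • (univ E).path l v := by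
  rw [gauge, CKFamily.lift_path]
  induction l with
  | nil => simp; rfl
  | cons e l ih =>
    have h : (gaugeFamily E z).S e = (z : ℂ) • (univ E).S e := rfl
    rw [CKFamily.path_cons, ih, CKFamily.path_cons, List.length_cons, pow_succ', h,
      smul_mul_smul_comm]

theorem gauge_monomial (z : Circle) (μ ν : List W) (v : V) :
    gauge E z ((univ E).path μ v * star ((univ E).path ν v))
      = ((z : ℂ) ^ μ.length * (starRingEnd ℂ) z ^ ν.length) •
        ((univ E).path μ v * star ((univ E).path ν v)) := by
  rw [map_mul, map_star, gauge_path, gauge_path, star_smul, smul_mul_smul_comm, star_pow]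
  rfl

theorem norm_gauge_le (z : Circle) (a : E.CStarAlg) : ‖gauge E z a‖ ≤ ‖a‖ :=
  NonUnitalStarAlgHom.norm_apply_le _ a

theorem gauge_one (hE : E.RowFinite) (a : E.CStarAlg) : gauge E 1 a = a := by
  let K : Submodule ℂ E.CStarAlg :=
    { carrier := {a | gauge E 1 a = a}
      add_mem' := fun {a b} ha hb => by
        change gauge E 1 (a + b) = a + b
        rw [map_add]; exact congrArg₂ _ ha hb
      zero_mem' := map_zero (gauge E 1)
      smul_mem' := fun c a ha => by
        change gauge E 1 (c • a) = c • a
        rw [map_smul]; exact congrArg _ ha }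
  have hK : IsClosed (K : Set E.CStarAlg) :=
    isClosed_eq (gaugeFamily E 1).liftCLM.continuous continuous_id
  refine monomial_induction hE K hK (fun μ ν v _ _ => ?_) a
  change gauge E 1 _ = _
  rw [gauge_monomial]
  simp

theorem continuous_gauge (hE : E.RowFinite) (a : E.CStarAlg) :
    Continuous fun z => gauge E z a := by
  let K : Submodule ℂ E.CStarAlg :=
    { carrier := {a | Continuous fun z => gauge E z a}
      add_mem' := fun {a b} ha hb => by
        change Continuous fun z => gauge E z (a + b)
        simp only [map_add]
        exact Continuous.add ha hb
      zero_mem' := by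
        change Continuous fun z => gauge E z 0
        simp only [map_zero]
        exact continuous_const
      smul_mem' := fun c a ha => by
        change Continuous fun z => gauge E z (c • a)
        simp only [map_smul]
        exact Continuous.const_smul ha c }
  -- the maps `gauge z` are contractive, so limits in `a` are uniform in `z`
  have hK : IsClosed (K : Set E.CStarAlg) := by
    refine isClosed_of_closure_subset fun b hb => ?_
    refine continuous_of_uniform_approx_of_continuous fun u hu => ?_
    obtain ⟨ε, hε, hu⟩ := Metric.mem_uniformity_dist.1 hu
    obtain ⟨c, hc, hbc⟩ := Metric.mem_closure_iff.1 hb ε hε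
    refine ⟨fun z => gauge E z c, hc, fun z => hu ?_⟩
    rw [dist_eq_norm, ← map_sub]
    exact (norm_gauge_le z _).trans_lt (by rwa [← dist_eq_norm])
  refine monomial_induction hE K hK (fun μ ν v _ _ => ?_) a
  change Continuous fun z => gauge E z _
  simp only [gauge_monomial]
  fun_prop

open Real MeasureTheory intervalIntegral

theorem continuous_gauge_exp (hE : E.RowFinite) (a : E.CStarAlg) :
    Continuous fun t => gauge E (Circle.exp t) a :=
  (continuous_gauge hE a).comp Circle.exp.continuous

/-- The expectation of `C*(E)` onto the fixed points of the gauge action: the average over the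
circle. -/
def expectation (hE : E.RowFinite) : E.CStarAlg →L[ℂ] E.CStarAlg :=
  LinearMap.mkContinuous
    { toFun := fun a => (2 * π)⁻¹ • ∫ t in (-π)..π, gauge E (Circle.exp t) a
      map_add' := fun a b => by
        simp only [map_add]
        rw [integral_add ((continuous_gauge_exp hE a).intervalIntegrable _ _)
          ((continuous_gauge_exp hE b).intervalIntegrable _ _), smul_add]
      map_smul' := fun c a => by
        simp only [map_smul]
        rw [intervalIntegral.integral_smul, smul_comm]
        rfl } 1
    (fun a => by
      have h := norm_integral_le_of_norm_le_const (a := -π) (b := π)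
        (f := fun t => gauge E (Circle.exp t) a) fun t _ => norm_gauge_le (Circle.exp t) a
      have hpi := Real.pi_pos
      rw [sub_neg_eq_add, ← two_mul, abs_of_pos (by positivity)] at h
      change ‖(2 * π)⁻¹ • ∫ t in (-π)..π, gauge E (Circle.exp t) a‖ ≤ 1 * ‖a‖
      rw [norm_smul, Real.norm_of_nonneg (by positivity), one_mul, inv_mul_le_iff₀ (by positivity),
        mul_comm]
      exact h)

theorem expectation_apply (hE : E.RowFinite) (a : E.CStarAlg) :
    expectation hE a = (2 * π)⁻¹ • ∫ t in (-π)..π, gauge E (Circle.exp t) a := rfl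

theorem integral_exp_pow (k l : ℕ) :
    ∫ t in (-π)..π, ((Circle.exp t : ℂ) ^ k * (starRingEnd ℂ) (Circle.exp t) ^ l)
      = if k = l then (2 * π : ℂ) else 0 := by
  have h : ∀ t : ℝ, ((Circle.exp t : ℂ) ^ k * (starRingEnd ℂ) (Circle.exp t) ^ l)
      = Complex.exp ((((k : ℤ) - l : ℤ) * Complex.I) * t) := by
    intro t
    rw [← Circle.coe_inv_eq_conj, ← Circle.exp_neg, Circle.coe_exp, Circle.coe_exp,
      ← Complex.exp_nat_mul, ← Complex.exp_nat_mul, ← Complex.exp_add]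
    congr 1
    push_cast
    ring
  simp only [h]
  split_ifs with hkl
  · subst hkl
    simp
    ring
  · have hc : ((((k : ℤ) - l : ℤ) : ℂ) * Complex.I) ≠ 0 := by
      refine mul_ne_zero ?_ Complex.I_ne_zero
      rw [Int.cast_ne_zero, sub_ne_zero]
      exact_mod_cast hkl
    rw [integral_exp_mul_complex hc, div_eq_zero_iff]
    left
    rw [sub_eq_zero, Complex.exp_eq_exp_iff_exists_int]
    refine ⟨(k : ℤ) - l, ?_⟩
    push_cast
    ring

theorem expectation_monomial (hE : E.RowFinite) (μ ν : List W) (v : V) :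
    expectation hE ((univ E).path μ v * star ((univ E).path ν v))
      = if μ.length = ν.length then (univ E).path μ v * star ((univ E).path ν v) else 0 := by
  rw [expectation_apply]
  simp only [gauge_monomial]
  rw [intervalIntegral.integral_smul_const, integral_exp_pow]
  split_ifs with h
  · rw [← Complex.coe_smul, smul_smul]
    have hpi := Real.pi_ne_zero
    have : ((2 * π)⁻¹ : ℝ) * (2 * π : ℂ) = 1 := by
      norm_cast
      exact inv_mul_cancel₀ (by positivity)
    rw [this, one_smul]
  · rw [zero_smul, smul_zero]

/-- The span of the monomials which are fixed by the gauge action. -/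
def coreSpan (E : DirectedGraph V W) : Submodule ℂ E.CStarAlg :=
  Submodule.span ℂ {x | ∃ μ ν v, μ.length = ν.length ∧ E.IsPath μ v ∧ E.IsPath ν v ∧
    x = (univ E).path μ v * star ((univ E).path ν v)}

theorem expectation_mem (hE : E.RowFinite) (a : E.CStarAlg) :
    expectation hE a ∈ (coreSpan E).topologicalClosure := by
  refine monomial_induction hE
    ((coreSpan E).topologicalClosure.comap (expectation hE : E.CStarAlg →ₗ[ℂ] E.CStarAlg))
    ((coreSpan E).isClosed_topologicalClosure.preimage (expectation hE).continuous)
    (fun μ ν v hμ hν => ?_) a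
  change expectation hE _ ∈ (coreSpan E).topologicalClosure
  rw [expectation_monomial]
  split_ifs with h
  · exact (coreSpan E).le_topologicalClosure (Submodule.subset_span ⟨μ, ν, v, h, hμ, hν, rfl⟩)
  · exact zero_mem _

/-- The expectation is faithful: the integral of a continuous function with positive values
vanishes only if the function does. -/
theorem eq_zero_of_expectation_eq_zero (hE : E.RowFinite) {a : E.CStarAlg}
    (h : expectation hE (star a * a) = 0) : a = 0 := by
  let _ := CStarAlgebra.spectralOrder E.CStarAlg
  have _ := CStarAlgebra.spectralOrderedRing E.CStarAlg
  have hpi := Real.pi_pos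
  set g : ℝ → E.CStarAlg := fun t => gauge E (Circle.exp t) (star a * a) with hg
  have hcont : Continuous g := continuous_gauge_exp hE _
  have hint : ∀ b c, IntervalIntegrable g volume b c := fun b c => hcont.intervalIntegrable b c
  have hnonneg : ∀ b c, b ≤ c → 0 ≤ ∫ t in b..c, g t := by
    intro b c hbc
    rw [integral_of_le hbc]
    refine MeasureTheory.integral_nonneg fun t => ?_
    change 0 ≤ gauge E (Circle.exp t) (star a * a)
    rw [map_mul, map_star]
    exact star_mul_self_nonneg _
  rw [expectation_apply, smul_eq_zero, inv_eq_zero] at h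
  -- the integral over any initial segment lies between zero and the whole integral, so it vanishes;
  -- its derivative at zero is `g 0 = star a * a`
  have h0 : ∫ t in (-π)..π, g t = 0 := h.resolve_left (by positivity)
  have hF : ∀ t ∈ Set.Icc (-π) π, ∫ s in (-π)..t, g s = 0 := by
    intro t ht
    refine le_antisymm ?_ (hnonneg _ _ ht.1)
    rw [← h0, ← integral_add_adjacent_intervals (hint (-π) t) (hint t π)]
    exact le_add_of_nonneg_right (hnonneg _ _ ht.2)
  have h1 : HasDerivAt (fun t => ∫ s in (-π)..t, g s) (g 0) 0 :=
    integral_hasDerivAt_right (hint _ _) (hcont.stronglyMeasurableAtFilter _ _) hcont.continuousAt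
  have h2 : HasDerivAt (fun t => ∫ s in (-π)..t, g s) 0 0 := by
    refine (hasDerivAt_const (0 : ℝ) (0 : E.CStarAlg)).congr_of_eventuallyEq ?_
    filter_upwards [Icc_mem_nhds (neg_neg_of_pos hpi) hpi] with t ht using hF t ht
  have h3 := h1.unique h2
  rw [hg] at h3
  simp only [Circle.exp_zero] at h3
  rw [gauge_one hE] at h3
  exact (CStarRing.star_mul_self_eq_zero_iff _).1 h3

end CStarAlg
end DirectedGraph

/-! ### Homomorphisms are isometric on the core -/

namespace DirectedGraph

variable {V W : Type*} {E : DirectedGraph V W}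

namespace CStarAlg

variable (E) in
/-- The elements `s_t` for a path `t`, given by its edges and its source. -/
def pathElt (t : List W × V) : E.CStarAlg := (univ E).path t.1 t.2

variable (E) in
/-- A set of paths such that distinct members have orthogonal ranges. -/
structure IsOrthogonalPaths (T : Set (List W × V)) : Prop where
  isPath : ∀ t ∈ T, E.IsPath t.1 t.2
  orth : ∀ t ∈ T, ∀ u ∈ T, t ≠ u → star (pathElt E t) * pathElt E u = 0

variable (E) in
/-- The span of the `s_t s_u^*` for `t, u` in a set of paths. -/
def matrixSpan (T : Set (List W × V)) : Submodule ℂ E.CStarAlg :=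
  Submodule.span ℂ {x | ∃ t ∈ T, ∃ u ∈ T, x = pathElt E t * star (pathElt E u)}

theorem matrixSpan_mono {T T' : Set (List W × V)} (h : T ⊆ T') : matrixSpan E T ≤ matrixSpan E T' :=
  Submodule.span_mono fun _ ⟨t, ht, u, hu, hx⟩ => ⟨t, h ht, u, h hu, hx⟩

theorem pathElt_mul_star_mem {T : Set (List W × V)} {t u : List W × V} (ht : t ∈ T) (hu : u ∈ T) :
    pathElt E t * star (pathElt E u) ∈ matrixSpan E T :=
  Submodule.subset_span ⟨t, ht, u, hu, rfl⟩

theorem pathElt_mul_star_mul (hE : E.RowFinite) {t : List W × V} (ht : E.IsPath t.1 t.2) :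
    pathElt E t * star (pathElt E t) * pathElt E t = pathElt E t := by
  rw [mul_assoc, pathElt, CKFamily.star_path_mul_path_self _ hE ht, CKFamily.path_mul_P]

namespace IsOrthogonalPaths

variable {T : Set (List W × V)}

theorem mul_mem_matrixSpan (hE : E.RowFinite) (hT : IsOrthogonalPaths E T) {a b : E.CStarAlg}
    (ha : a ∈ matrixSpan E T) (hb : b ∈ matrixSpan E T) : a * b ∈ matrixSpan E T := by
  induction ha using Submodule.span_induction with
  | zero => rw [zero_mul]; exact zero_mem _
  | add a a' _ _ ha ha' => rw [add_mul]; exact add_mem ha ha'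
  | smul c a _ ha => rw [smul_mul_assoc]; exact Submodule.smul_mem _ c ha
  | mem a ha =>
    induction hb using Submodule.span_induction with
    | zero => rw [mul_zero]; exact zero_mem _
    | add b b' _ _ hb hb' => rw [mul_add]; exact add_mem hb hb'
    | smul c b _ hb => rw [mul_smul_comm]; exact Submodule.smul_mem _ c hb
    | mem b hb =>
      obtain ⟨t, ht, u, hu, rfl⟩ := ha
      obtain ⟨t', ht', u', hu', rfl⟩ := hb
      by_cases h : u = t'
      · subst h
        have h1 : star (pathElt E u) * pathElt E u * star (pathElt E u) = star (pathElt E u) := by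
          have := congrArg star (pathElt_mul_star_mul hE (hT.isPath u hu))
          simpa only [star_mul, star_star, mul_assoc] using this
        by_cases hv : t.2 = u.2
        · have h2 : pathElt E t * (star (pathElt E u) * pathElt E u) = pathElt E t := by
            rw [pathElt, pathElt, CKFamily.star_path_mul_path_self _ hE (hT.isPath u hu), ← hv,
              CKFamily.path_mul_P]
          rw [mul_assoc, ← mul_assoc (star _), ← mul_assoc, h2]
          exact pathElt_mul_star_mem ht hu'
        · have h2 : pathElt E t * (star (pathElt E u) * pathElt E u) = 0 := by
            rw [pathElt, pathElt, CKFamily.star_path_mul_path_self _ hE (hT.isPath u hu),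
              CKFamily.path_mul_P_of_ne _ _ hv]
          rw [mul_assoc, ← mul_assoc (star _), ← mul_assoc, h2, zero_mul]
          exact zero_mem _
      · rw [mul_assoc, ← mul_assoc (star _), hT.orth u hu t' ht' h, zero_mul, mul_zero]
        exact zero_mem _

theorem star_mem_matrixSpan {a : E.CStarAlg} (ha : a ∈ matrixSpan E T) :
    star a ∈ matrixSpan E T := by
  induction ha using Submodule.span_induction with
  | zero => rw [star_zero]; exact zero_mem _
  | add a a' _ _ ha ha' => rw [star_add]; exact add_mem ha ha'
  | smul c a _ ha => rw [star_smul]; exact Submodule.smul_mem _ _ ha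
  | mem a ha =>
    obtain ⟨t, ht, u, hu, rfl⟩ := ha
    rw [star_mul, star_star]
    exact pathElt_mul_star_mem hu ht

/-- The `*`-algebra spanned by the matrix units `s_t s_u^*`. -/
def subalgebra (hE : E.RowFinite) (hT : IsOrthogonalPaths E T) :
    NonUnitalStarSubalgebra ℂ E.CStarAlg where
  __ := matrixSpan E T
  mul_mem' := hT.mul_mem_matrixSpan hE
  star_mem' := star_mem_matrixSpan

end IsOrthogonalPaths

theorem isClosed_matrixSpan (T : Finset (List W × V)) :
    IsClosed (matrixSpan E (T : Set (List W × V)) : Set E.CStarAlg) := by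
  have hfin : {x | ∃ t ∈ (T : Set (List W × V)), ∃ u ∈ (T : Set (List W × V)),
      x = pathElt E t * star (pathElt E u)}.Finite := by
    refine ((T ×ˢ T).finite_toSet.image
      fun q : (List W × V) × (List W × V) => pathElt E q.1 * star (pathElt E q.2)).subset ?_
    rintro _ ⟨t, ht, u, hu, rfl⟩
    exact ⟨(t, u), by simpa using And.intro ht hu, rfl⟩
  have : FiniteDimensional ℂ (matrixSpan E (T : Set (List W × V))) :=
    FiniteDimensional.span_of_finite ℂ hfin
  exact Submodule.closed_of_finiteDimensional _

section Isometric

variable {B : Type*} [NonUnitalCStarAlgebra B] (π : E.CStarAlg →⋆ₙₐ[ℂ] B)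

theorem sum_mul_of_mem_matrixSpan (hE : E.RowFinite) {T : Finset (List W × V)}
    (hT : IsOrthogonalPaths E T) {c : E.CStarAlg} (hc : c ∈ matrixSpan E T) :
    (∑ t ∈ T, pathElt E t * star (pathElt E t)) * c = c := by
  classical
  induction hc using Submodule.span_induction with
  | zero => rw [mul_zero]
  | add a b _ _ ha hb => rw [mul_add, ha, hb]
  | smul c a _ ha => rw [mul_smul_comm, ha]
  | mem a ha =>
    obtain ⟨t, ht, u, hu, rfl⟩ := ha
    rw [← mul_assoc, Finset.sum_mul, Finset.sum_eq_single t]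
    · rw [pathElt_mul_star_mul hE (hT.isPath t ht)]
    · intro s hs hst
      rw [mul_assoc, hT.orth s hs t ht hst, mul_zero]
    · exact fun h => absurd ht h

/-- Compressing an element of the span of the matrix units gives a multiple of a matrix unit. -/
theorem exists_compression (hE : E.RowFinite) {T : Set (List W × V)}
    (hT : IsOrthogonalPaths E T) {c : E.CStarAlg} (hc : c ∈ matrixSpan E T) {t u : List W × V}
    (ht : t ∈ T) (hu : u ∈ T) :
    ∃ r : ℂ, pathElt E t * star (pathElt E t) * c * (pathElt E u * star (pathElt E u))
      = r • (pathElt E t * star (pathElt E u)) := by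
  induction hc using Submodule.span_induction with
  | zero => exact ⟨0, by simp⟩
  | add a b _ _ ha hb =>
    obtain ⟨r, hr⟩ := ha
    obtain ⟨s, hs⟩ := hb
    exact ⟨r + s, by rw [mul_add, add_mul, hr, hs, add_smul]⟩
  | smul c a _ ha =>
    obtain ⟨r, hr⟩ := ha
    exact ⟨c * r, by rw [mul_smul_comm, smul_mul_assoc, hr, mul_smul]⟩
  | mem a ha =>
    obtain ⟨t', ht', u', hu', rfl⟩ := ha
    by_cases h1 : t = t'
    · by_cases h2 : u' = u
      · subst h1 h2
        have h3 := congrArg star (pathElt_mul_star_mul hE (hT.isPath u' hu'))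
        simp only [star_mul, star_star] at h3
        refine ⟨1, ?_⟩
        rw [← mul_assoc (pathElt E t * star (pathElt E t)),
          pathElt_mul_star_mul hE (hT.isPath t ht), mul_assoc, h3, one_smul]
      · refine ⟨0, ?_⟩
        rw [mul_assoc, mul_assoc (pathElt E t'), ← mul_assoc (star (pathElt E u')),
          hT.orth u' hu' u hu h2, zero_mul, mul_zero, mul_zero, zero_smul]
    · refine ⟨0, ?_⟩
      rw [← mul_assoc (pathElt E t * star (pathElt E t)), mul_assoc (pathElt E t),
        hT.orth t ht t' ht' h1, mul_zero, zero_mul, zero_mul, zero_smul]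

/-- A homomorphism which does not vanish on the vertex projections is injective on the span of the
matrix units: it detects each matrix coefficient. -/
theorem eq_zero_of_map_eq_zero (hE : E.RowFinite) (hπ : ∀ v, π ((univ E).P v) ≠ 0)
    {T : Finset (List W × V)} (hT : IsOrthogonalPaths E T) {c : E.CStarAlg}
    (hc : c ∈ matrixSpan E T) (h : π c = 0) : c = 0 := by
  have h1 := sum_mul_of_mem_matrixSpan hE hT hc
  have h2 := congrArg star
    (sum_mul_of_mem_matrixSpan hE hT (IsOrthogonalPaths.star_mem_matrixSpan hc))
  simp only [star_mul, star_sum, star_star] at h2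
  rw [← h2, ← h1, Finset.sum_mul, Finset.sum_mul]
  refine Finset.sum_eq_zero fun t ht => ?_
  rw [Finset.mul_sum]
  refine Finset.sum_eq_zero fun u hu => ?_
  obtain ⟨r, hr⟩ := exists_compression hE hT hc (t := t) (u := u) ht hu
  rw [hr]
  by_cases hv : t.2 = u.2
  · have h3 := congrArg (fun x => π (star (pathElt E t) * x * pathElt E u)) hr
    have h4 : star (pathElt E t) * (pathElt E t * star (pathElt E u)) * pathElt E u
        = (univ E).P t.2 := by
      rw [← mul_assoc, mul_assoc, pathElt, pathElt,
        CKFamily.star_path_mul_path_self _ hE (hT.isPath u hu),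
        CKFamily.star_path_mul_path_self _ hE (hT.isPath t ht), ← hv, CKFamily.P_mul_self]
    simp only [mul_smul_comm, smul_mul_assoc, h4, map_smul] at h3
    simp only [map_mul, h, zero_mul, mul_zero] at h3
    rcases smul_eq_zero.1 h3.symm with h5 | h5
    · rw [h5, zero_smul]
    · exact absurd h5 (hπ _)
  · rw [pathElt, pathElt, ← CKFamily.P_mul_star_path, ← mul_assoc,
      CKFamily.path_mul_P_of_ne _ _ hv, zero_mul, smul_zero]

theorem norm_map_of_mem_matrixSpan (hE : E.RowFinite) (hπ : ∀ v, π ((univ E).P v) ≠ 0)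
    {T : Finset (List W × V)} (hT : IsOrthogonalPaths E T) {c : E.CStarAlg}
    (hc : c ∈ matrixSpan E T) : ‖π c‖ = ‖c‖ := by
  have hclosed : IsClosed (hT.subalgebra hE : Set E.CStarAlg) := isClosed_matrixSpan T
  let _ : NonUnitalCStarAlgebra (hT.subalgebra hE) :=
    NonUnitalStarSubalgebra.nonUnitalCStarAlgebra _ (h_closed := hclosed)
  let ρ : hT.subalgebra hE →⋆ₙₐ[ℂ] B := π.comp (NonUnitalStarSubalgebraClass.subtype _)
  have hρ : Function.Injective ρ := by
    rw [injective_iff_map_eq_zero]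
    intro a ha
    exact Subtype.ext (eq_zero_of_map_eq_zero π hE hπ hT a.2 ha)
  exact NonUnitalStarAlgHom.norm_map ρ hρ ⟨c, hc⟩

end Isometric

variable (E) in
/-- The paths of length `n`, and the shorter paths which cannot be extended. -/
def maximalPaths (n : ℕ) : Set (List W × V) :=
  {t | E.IsPath t.1 t.2 ∧ (t.1.length = n ∨ t.1.length < n ∧ ∀ e, E.r e ≠ t.2)}

theorem isOrthogonalPaths_maximalPaths (hE : E.RowFinite) (n : ℕ) :
    IsOrthogonalPaths E (maximalPaths E n) := by
  have key : ∀ t ∈ maximalPaths E n, ∀ u ∈ maximalPaths E n, t ≠ u → t.1 <+: u.1 →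
      star (pathElt E t) * pathElt E u = 0 := by
    rintro ⟨μ, v⟩ ⟨hμ, ht⟩ ⟨ν, w⟩ ⟨hν, hu⟩ hne ⟨α, rfl⟩
    refine CKFamily.star_path_mul_path_of_ne_vertex _ hE α μ fun hr => ?_
    cases α with
    | nil =>
      have hr : w = v := hr
      exact hne (by simp [hr])
    | cons e α =>
      have h1 := ht.resolve_right fun h => h.2 e hr
      simp only [List.length_append, List.length_cons] at h1 hu
      omega
  refine ⟨fun t ht => ht.1, fun t ht u hu hne => ?_⟩
  by_cases h1 : t.1 <+: u.1
  · exact key t ht u hu hne h1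
  · by_cases h2 : u.1 <+: t.1
    · rw [← star_star (star _ * _), star_mul, star_star, key u hu t ht hne.symm h2, star_zero]
    · exact CKFamily.star_path_mul_path_of_not_prefix _ hE _ _ h1 h2

theorem path_mul_star_path_eq_sum (hE : E.RowFinite) (μ ν : List W) {v : V}
    (h : ∃ e, E.r e = v) :
    (univ E).path μ v * star ((univ E).path ν v) = ∑ e ∈ (hE v).toFinset,
      (univ E).path (μ ++ [e]) (E.s e) * star ((univ E).path (ν ++ [e]) (E.s e)) := by
  conv_lhs => rw [← CKFamily.path_mul_P, (univ E).P_eq_sum v (hE v) h, Finset.mul_sum,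
    Finset.sum_mul]
  refine Finset.sum_congr rfl fun e he => ?_
  have he : E.r e = v := by simpa using he
  rw [CKFamily.path_append _ hE, CKFamily.path_append _ hE, rangeOf_cons, he, CKFamily.path_cons,
    CKFamily.path_nil, CKFamily.S_mul_P, star_mul]
  simp only [mul_assoc]

/-- A monomial of degree zero is expanded, by the relation at its source vertex, into monomials
whose paths have length `n` or cannot be extended. -/
theorem path_mul_star_path_mem_matrixSpan (hE : E.RowFinite) {n : ℕ} (k : ℕ) {μ ν : List W} {v : V}
    (hμ : E.IsPath μ v) (hν : E.IsPath ν v) (hl : μ.length = ν.length) (hn : μ.length + k = n) :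
    (univ E).path μ v * star ((univ E).path ν v) ∈ matrixSpan E (maximalPaths E n) := by
  induction k generalizing μ ν v with
  | zero =>
    exact pathElt_mul_star_mem (t := (μ, v)) (u := (ν, v)) ⟨hμ, .inl hn⟩
      ⟨hν, .inl (hl.symm.trans hn)⟩
  | succ k ih =>
    by_cases h : ∃ e, E.r e = v
    · rw [path_mul_star_path_eq_sum hE μ ν h]
      refine sum_mem fun e he => ?_
      have he : E.r e = v := by simpa using he
      exact ih (by simpa [isPath_append, he] using hμ) (by simpa [isPath_append, he] using hν)
        (by simpa using hl) (by simp; omega)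
    · push Not at h
      exact pathElt_mul_star_mem (t := (μ, v)) (u := (ν, v)) ⟨hμ, .inr ⟨by simp; omega, h⟩⟩
        ⟨hν, .inr ⟨by simp; omega, h⟩⟩

theorem exists_mem_matrixSpan_maximalPaths (hE : E.RowFinite) {c : E.CStarAlg}
    (hc : c ∈ coreSpan E) : ∃ n₀, ∀ n ≥ n₀, c ∈ matrixSpan E (maximalPaths E n) := by
  induction hc using Submodule.span_induction with
  | zero => exact ⟨0, fun n _ => zero_mem _⟩
  | add a b _ _ ha hb =>
    obtain ⟨m, hm⟩ := ha
    obtain ⟨n, hn⟩ := hb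
    exact ⟨max m n, fun k hk => add_mem (hm k (by omega)) (hn k (by omega))⟩
  | smul c a _ ha =>
    obtain ⟨m, hm⟩ := ha
    exact ⟨m, fun k hk => Submodule.smul_mem _ c (hm k hk)⟩
  | mem a ha =>
    obtain ⟨μ, ν, v, hl, hμ, hν, rfl⟩ := ha
    exact ⟨μ.length, fun n hn =>
      path_mul_star_path_mem_matrixSpan hE (n - μ.length) hμ hν hl (by omega)⟩

theorem exists_finset_mem_matrixSpan {T : Set (List W × V)} {c : E.CStarAlg}
    (hc : c ∈ matrixSpan E T) : ∃ T' : Finset (List W × V), (T' : Set (List W × V)) ⊆ T ∧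
      c ∈ matrixSpan E (T' : Set (List W × V)) := by
  classical
  induction hc using Submodule.span_induction with
  | zero => exact ⟨∅, by simp, zero_mem _⟩
  | add a b _ _ ha hb =>
    obtain ⟨T₁, h₁, h₁'⟩ := ha
    obtain ⟨T₂, h₂, h₂'⟩ := hb
    exact ⟨T₁ ∪ T₂, by simp [h₁, h₂], add_mem (matrixSpan_mono (by simp) h₁')
      (matrixSpan_mono (by simp) h₂')⟩
  | smul c a _ ha =>
    obtain ⟨T₁, h₁, h₁'⟩ := ha
    exact ⟨T₁, h₁, Submodule.smul_mem _ c h₁'⟩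
  | mem a ha =>
    obtain ⟨t, ht, u, hu, rfl⟩ := ha
    exact ⟨{t, u}, by simp [Set.insert_subset_iff, ht, hu],
      pathElt_mul_star_mem (by simp) (by simp)⟩

/-- A homomorphism which does not vanish on the vertex projections is isometric on the closed span
of the monomials which are fixed by the gauge action. -/
theorem norm_map_of_mem_core (hE : E.RowFinite) {B : Type*} [NonUnitalCStarAlgebra B]
    (π : E.CStarAlg →⋆ₙₐ[ℂ] B) (hπ : ∀ v, π ((univ E).P v) ≠ 0) {c : E.CStarAlg}
    (hc : c ∈ (coreSpan E).topologicalClosure) : ‖π c‖ = ‖c‖ := by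
  have hclosed : IsClosed {c | ‖π c‖ = ‖c‖} :=
    isClosed_eq (continuous_nonUnitalStarAlgHom π).norm continuous_norm
  refine hclosed.closure_subset_iff.2 (fun c hc => ?_) hc
  obtain ⟨n, hn⟩ := exists_mem_matrixSpan_maximalPaths hE hc
  obtain ⟨T, hT, hcT⟩ := exists_finset_mem_matrixSpan (hn n le_rfl)
  have h := isOrthogonalPaths_maximalPaths hE n
  exact norm_map_of_mem_matrixSpan π hE hπ
    ⟨fun t ht => h.isPath t (hT ht), fun t ht u hu => h.orth t (hT ht) u (hT hu)⟩ hcT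

end CStarAlg
end DirectedGraph

/-! ### Aperiodic paths -/

namespace DirectedGraph

variable {V W : Type*} {E : DirectedGraph V W}

theorem IsPath.range_getElem {l : List W} {v : V} (h : E.IsPath l v) (k : ℕ)
    (hk : k + 1 < l.length) : E.r l[k + 1] = E.s l[k] := by
  induction l generalizing k with
  | nil => simp at hk
  | cons e l ih =>
    cases k with
    | zero =>
      cases l with
      | nil => simp at hk
      | cons f l => exact h.1.symm
    | succ k => exact ih h.2 k (by simpa using hk)

/-- The word `l` does not have any of the periods `1, …, M`. -/
def Aperiodic (M : ℕ) (l : List W) : Prop :=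
  ∀ d, 1 ≤ d → d ≤ M → ∃ j, j + d < l.length ∧ l[j + d]? ≠ l[j]?

/-- Under condition (L) there is an aperiodic path with any prescribed range from which long paths
start: a long path with a period runs around a cycle, and leaving it through an entry after two
periods destroys all short periods. -/
theorem ConditionL.exists_aperiodic (hL : E.ConditionL) (M : ℕ) {l : List W} {v : V}
    (hl : E.IsPath l v) (hlen : l.length = 3 * M + 1) :
    ∃ κ w, E.IsPath κ w ∧ E.rangeOf κ w = E.rangeOf l v ∧ Aperiodic M κ := by
  by_cases hp : Aperiodic M l
  · exact ⟨l, v, hl, rfl, hp⟩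
  unfold Aperiodic at hp
  push Not at hp
  obtain ⟨d, hd1, hdM, hper⟩ := hp
  have hper' : ∀ j (h : j + d < l.length), l[j + d] = l[j] := by
    intro j h
    have := hper j h
    rw [List.getElem?_eq_getElem h, List.getElem?_eq_getElem (by omega)] at this
    exact Option.some.inj this
  obtain ⟨n, rfl⟩ : ∃ n, d = n + 1 := ⟨d - 1, by omega⟩
  have hret : E.IsReturnPath fun i : Fin (n + 1) => l[2 * M + i.1]'(by omega) := by
    refine ⟨fun i => hl.range_getElem (2 * M + i.1) (by omega), ?_⟩
    have h1 := hl.range_getElem (2 * M + n) (by omega)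
    have h2 := hper' (2 * M) (by omega)
    simp only [← add_assoc] at h2
    rw [h2] at h1
    exact h1
  obtain ⟨i, f, hf, hfne⟩ := hL n _ hret
  -- an entry `f` at a position `P ≥ 2 * M` leaves room for both the old and a new period before it
  set P := 2 * M + i.1 with hP
  have hPl : P < l.length := by omega
  have hf : E.r f = E.r l[P] := hf
  have hfne : f ≠ l[P] := hfne
  have hdec : l = l.take P ++ l[P] :: l.drop (P + 1) := by
    rw [List.getElem_cons_drop, List.take_append_drop]
  have hl' := hl
  rw [hdec, isPath_append] at hl'
  refine ⟨l.take P ++ [f], E.s f, ?_, ?_, ?_⟩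
  · rw [isPath_append]
    refine ⟨?_, rfl, trivial⟩
    rw [rangeOf_cons, hf]
    exact hl'.1
  · conv_rhs => rw [hdec]
    rw [rangeOf_append, rangeOf_append, rangeOf_cons, rangeOf_cons, hf]
  · intro d' hd1' hdM'
    by_contra hper2
    push Not at hper2
    have hlen2 : (l.take P ++ [f]).length = P + 1 := by
      rw [List.length_append, List.length_take, min_eq_left hPl.le, List.length_singleton]
    have hget : ∀ j < P, (l.take P ++ [f])[j]? = l[j]? := by
      intro j hj
      rw [List.getElem?_append_left (by rw [List.length_take]; omega), List.getElem?_take_of_lt hj]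
    have hgetP : (l.take P ++ [f])[P]? = some f := by
      rw [List.getElem?_append_right (by rw [List.length_take]; omega), List.length_take,
        min_eq_left hPl.le, Nat.sub_self]
      rfl
    -- going back by `d'`, back by the old period, and forth by `d'` turns the letter `f` at `P`
    -- into the letter of `l` one old period before `P`, which is the letter of `l` at `P`
    have h1 := hper2 (P - d') (by omega)
    rw [Nat.sub_add_cancel (by omega), hgetP, hget _ (by omega)] at h1
    have h2 := hper (P - d' - (n + 1)) (by omega)
    rw [Nat.sub_add_cancel (by omega)] at h2
    have h3 := hper2 (P - d' - (n + 1)) (by omega)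
    rw [hget _ (by omega), hget _ (by omega),
      show P - d' - (n + 1) + d' = P - (n + 1) by omega] at h3
    have h4 := hper (P - (n + 1)) (by omega)
    rw [Nat.sub_add_cancel (by omega)] at h4
    rw [h2, ← h3, ← h4, List.getElem?_eq_getElem hPl] at h1
    exact hfne (Option.some.inj h1)

/-! ### Paths which separate the monomials -/

namespace BoundaryPath

theorem StartsWith.range_eq {x : E.BoundaryPath} {l : List W} {v : V} (h : x.StartsWith l v) :
    x.range = E.rangeOf l v := by
  cases l with
  | nil => exact h
  | cons e l => rw [BoundaryPath.range, h.1]; rfl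

theorem StartsWith.isPath {x : E.BoundaryPath} {l : List W} {v : V} (h : x.StartsWith l v) :
    E.IsPath l v := by
  induction l generalizing x with
  | nil => trivial
  | cons e l ih => exact ⟨(range_tail h.1).trans h.2.range_eq, ih h.2⟩

theorem StartsWith.of_append {x : E.BoundaryPath} {μ α : List W} {w : V}
    (h : x.StartsWith (μ ++ α) w) : x.StartsWith μ (E.rangeOf α w) := by
  induction μ generalizing x with
  | nil => exact h.range_eq
  | cons e μ ih => exact ⟨h.1, ih h.2⟩

theorem StartsWith.exists_append {x : E.BoundaryPath} {μ τ : List W} {v w : V}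
    (hμ : x.StartsWith μ v) (hτ : x.StartsWith τ w) (hl : μ.length ≤ τ.length) :
    ∃ α, τ = μ ++ α ∧ E.rangeOf α w = v := by
  have h : x.StartsWith (τ.take μ.length ++ τ.drop μ.length) w := by
    rwa [List.take_append_drop]
  obtain ⟨h1, h2⟩ := h.of_append.unique hμ (by rw [List.length_take]; omega)
  exact ⟨τ.drop μ.length, (List.take_append_drop μ.length τ).symm.trans (by rw [h1]), h2⟩

/-- A boundary path either has a beginning of length `n`, or it starts at a source of the graph. -/
theorem exists_startsWith (n : ℕ) (x : E.BoundaryPath) :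
    (∃ τ w, x.StartsWith τ w ∧ τ.length = n) ∨ ∃ τ w, x.StartsWith τ w ∧ ∀ e, E.r e ≠ w := by
  induction n generalizing x with
  | zero => exact .inl ⟨[], x.range, rfl, rfl⟩
  | succ n ih =>
    cases h : x.letter 0 with
    | inl e =>
      rcases ih x.tail with ⟨τ, w, h1, h2⟩ | ⟨τ, w, h1, h2⟩
      · exact .inl ⟨e :: τ, w, ⟨h, h1⟩, by simp [h2]⟩
      · exact .inr ⟨e :: τ, w, ⟨h, h1⟩, h2⟩
    | inr w =>
      refine .inr ⟨[], w, ?_, x.source 0 w h⟩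
      change x.range = w
      rw [BoundaryPath.range, h]
      rfl

end BoundaryPath

namespace CKFamily

variable {B : Type*} [NonUnitalCStarAlgebra B] (F : E.CKFamily B)

/-- The path `(τ, w)` follows the boundary path `x` on beginnings of length at most `M`, and shifts
of `τ` by different lengths at most `M` have orthogonal ranges. -/
structure Separates (x : E.BoundaryPath) (M : ℕ) (τ : List W) (w : V) : Prop where
  isPath : E.IsPath τ w
  exists_append : ∀ μ v, μ.length ≤ M → x.StartsWith μ v → ∃ α, τ = μ ++ α ∧ E.rangeOf α w = v
  eq_zero : ∀ μ v, μ.length ≤ M → ¬ x.StartsWith μ v → star (F.path τ w) * F.path μ v = 0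
  shift : ∀ μ ν α β, μ.length < ν.length → ν.length ≤ M → τ = μ ++ α → τ = ν ++ β →
    star (F.path α w) * F.path β w = 0

theorem star_path_append_mul_path_of_ne (hE : E.RowFinite) (α : List W) {v w : V} (μ : List W)
    (hr : E.rangeOf α w ≠ v) : star (F.path (μ ++ α) w) * F.path μ v = 0 := by
  rw [← star_star (_ * _), star_mul, star_star, F.star_path_mul_path_of_ne_vertex hE α μ hr,
    star_zero]

theorem separates_of_source (hE : E.RowFinite) {x : E.BoundaryPath} (M : ℕ) {τ : List W} {w : V}
    (hx : x.StartsWith τ w) (hw : ∀ e, E.r e ≠ w) : F.Separates x M τ w where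
  isPath := hx.isPath
  exists_append μ v _ h := by
    rcases le_total μ.length τ.length with hl | hl
    · exact h.exists_append hx hl
    · obtain ⟨α, rfl, h2⟩ := hx.exists_append h hl
      cases α with
      | nil => exact ⟨[], by simp, h2.symm⟩
      | cons e α => exact absurd h2 (hw e)
  eq_zero μ v _ h := by
    by_cases h1 : μ <+: τ
    · obtain ⟨α, rfl⟩ := h1
      refine F.star_path_append_mul_path_of_ne hE α μ ?_
      rintro rfl
      exact h hx.of_append
    · by_cases h2 : τ <+: μ
      · obtain ⟨α, rfl⟩ := h2
        cases α with
        | nil => exact absurd (by simp) h1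
        | cons e α => exact F.star_path_mul_path_of_ne_vertex hE _ _ (hw e)
      · exact F.star_path_mul_path_of_not_prefix hE _ _ h2 h1
  shift μ ν α β hl _ hμ hν := by
    have hlen : α.length = β.length + (ν.length - μ.length) := by
      have := congrArg List.length (hμ.symm.trans hν)
      simp only [List.length_append] at this
      omega
    by_cases h1 : β <+: α
    · obtain ⟨γ, rfl⟩ := h1
      cases γ with
      | nil => simp at hlen; omega
      | cons e γ => exact F.star_path_append_mul_path_of_ne hE _ _ (hw e)
    · refine F.star_path_mul_path_of_not_prefix hE _ _ (fun h => ?_) h1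
      have := h.length_le
      omega

theorem separates_of_aperiodic (hE : E.RowFinite) {x : E.BoundaryPath} {M : ℕ} {ξ κ : List W}
    {w : V} (hξ : x.StartsWith ξ (E.rangeOf κ w)) (hM : ξ.length = M) (hκ : E.IsPath κ w)
    (hap : Aperiodic M κ) : F.Separates x M (ξ ++ κ) w where
  isPath := (isPath_append _ _ _).2 ⟨hξ.isPath, hκ⟩
  exists_append μ v hl h := by
    obtain ⟨α, rfl, h2⟩ := h.exists_append hξ (hl.trans hM.ge)
    exact ⟨α ++ κ, by simp, by rw [rangeOf_append, h2]⟩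
  eq_zero μ v hl h := by
    by_cases h1 : μ <+: ξ ++ κ
    · obtain ⟨α, rfl⟩ := List.prefix_of_prefix_length_le h1
        (List.prefix_append ξ κ) (hl.trans hM.ge)
      rw [List.append_assoc]
      refine F.star_path_append_mul_path_of_ne hE _ μ ?_
      rintro rfl
      rw [rangeOf_append] at h
      exact h hξ.of_append
    · refine F.star_path_mul_path_of_not_prefix hE _ _ (fun h2 => h1 ?_) h1
      have h3 := h2.length_le
      rw [List.length_append] at h3
      rw [h2.eq_of_length (by rw [List.length_append]; omega)]
  shift μ ν α β hl hlM hμ hν := by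
    have hlen : α.length = β.length + (ν.length - μ.length) := by
      have := congrArg List.length (hμ.symm.trans hν)
      simp only [List.length_append] at this
      omega
    refine F.star_path_mul_path_of_not_prefix hE _ _ (fun h => ?_) fun h => ?_
    · have := h.length_le
      omega
    · obtain ⟨j, hj, hne⟩ := hap (ν.length - μ.length) (by omega) (by omega)
      refine hne ?_
      have hlen2 := congrArg List.length hν
      simp only [List.length_append] at hlen2
      -- if `β` were a beginning of `α`, then `κ` would have the period `|ν| - |μ|`
      have hκ' : ∀ i, κ[i]? = (ξ ++ κ)[M + i]? := fun i => by
        rw [List.getElem?_append_right (by omega), hM, Nat.add_sub_cancel_left]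
      have h1 : κ[j + (ν.length - μ.length)]? = β[M + j - μ.length]? := by
        rw [hκ', hν, List.getElem?_append_right (by omega)]
        congr 1
        omega
      have h2 : κ[j]? = α[M + j - μ.length]? := by
        rw [hκ', hμ, List.getElem?_append_right (by omega)]
      obtain ⟨γ, rfl⟩ := h
      rw [h1, h2, List.getElem?_append_left (by omega)]

theorem exists_separates (hE : E.RowFinite) (hL : E.ConditionL) (x : E.BoundaryPath) (M : ℕ) :
    ∃ τ w, F.Separates x M τ w := by
  rcases x.exists_startsWith (M + (3 * M + 1)) with ⟨τ, w, hx, hlen⟩ | ⟨τ, w, hx, hw⟩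
  · have hdec : τ = τ.take M ++ τ.drop M := (List.take_append_drop M τ).symm
    rw [hdec] at hx
    have h1 := ((isPath_append _ _ _).1 hx.isPath).2
    obtain ⟨κ, w', hκ, hr, hap⟩ := hL.exists_aperiodic M h1 (by rw [List.length_drop]; omega)
    have h2 := hx.of_append
    rw [← hr] at h2
    exact ⟨_, w', F.separates_of_aperiodic hE h2 (by rw [List.length_take]; omega) hκ hap⟩
  · exact ⟨τ, w, F.separates_of_source hE M hx hw⟩

open scoped Classical in
/-- A separating path compresses each short monomial to its diagonal coefficient. -/
theorem Separates.compress (hE : E.RowFinite) {F : E.CKFamily B} {x : E.BoundaryPath} {M : ℕ}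
    {τ : List W} {w : V} (h : F.Separates x M τ w) {μ ν : List W} {v : V} (hμ : μ.length ≤ M)
    (hν : ν.length ≤ M) (hμp : E.IsPath μ v) (hνp : E.IsPath ν v) :
    star (F.path τ w) * (F.path μ v * star (F.path ν v)) * F.path τ w
      = (if μ = ν ∧ x.StartsWith μ v then (1 : ℂ) else 0) • F.P w := by
  by_cases h1 : x.StartsWith μ v
  · by_cases h2 : x.StartsWith ν v
    · obtain ⟨α, hα, hαr⟩ := h.exists_append μ v hμ h1
      obtain ⟨β, hβ, hβr⟩ := h.exists_append ν v hν h2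
      have h3 : star (F.path τ w) * F.path μ v = star (F.path α w) := by
        rw [hα, F.star_path_append_mul_path hE α w hμp hαr]
      have h4 : star (F.path ν v) * F.path τ w = F.path β w := by
        rw [hβ, F.star_path_mul_path_append hE β w hνp hβr]
      rw [← mul_assoc, h3, mul_assoc, h4]
      rcases lt_trichotomy μ.length ν.length with hl | hl | hl
      · rw [h.shift μ ν α β hl hν hα hβ, if_neg (fun h => hl.ne (congrArg _ h.1)), zero_smul]
      · obtain ⟨rfl, -⟩ := h1.unique h2 hl
        obtain rfl := List.append_cancel_left (hα.symm.trans hβ)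
        have hp := h.isPath
        rw [hα, isPath_append] at hp
        rw [F.star_path_mul_path_self hE hp.2, if_pos ⟨rfl, h1⟩, one_smul]
      · have h5 := congrArg star (h.shift ν μ β α hl hμ hβ hα)
        rw [star_mul, star_star, star_zero] at h5
        rw [h5, if_neg (fun h => hl.ne' (congrArg _ h.1)), zero_smul]
    · have h5 := congrArg star (h.eq_zero ν v hν h2)
      rw [star_mul, star_star, star_zero] at h5
      rw [mul_assoc, mul_assoc (F.path μ v), h5, mul_zero, mul_zero, if_neg, zero_smul]
      rintro ⟨rfl, h⟩
      exact h2 h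
  · rw [← mul_assoc, h.eq_zero μ v hμ h1, zero_mul, zero_mul, if_neg (fun h => h1 h.2), zero_smul]

end CKFamily

end DirectedGraph

/-! ### The ideal intersection property under condition (L) -/

namespace DirectedGraph

variable {V W : Type*} {E : DirectedGraph V W}

namespace CStarAlg

open scoped lp

open scoped Classical in
/-- The functional `a ↦ ⟨δ_x, Φ(a) δ_x⟩`, where `Φ` is the expectation onto the fixed points of the
gauge action and `δ_x` is the basis vector of the boundary path `x`. It evaluates at `x` the
conditional expectation onto the diagonal. -/
def diagFunctional (hE : E.RowFinite) (x : E.BoundaryPath) : E.CStarAlg →L[ℂ] ℂ :=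
  innerSL ℂ (lp.single 2 x (1 : ℂ) : ℓ²(E.BoundaryPath, ℂ)) ∘L
    ContinuousLinearMap.apply ℂ _ (lp.single 2 x (1 : ℂ) : ℓ²(E.BoundaryPath, ℂ)) ∘L
    (boundaryFamily E).liftCLM ∘L expectation hE

open scoped Classical in
theorem diagFunctional_apply (hE : E.RowFinite) (x : E.BoundaryPath) (a : E.CStarAlg) :
    diagFunctional hE x a = inner ℂ (lp.single 2 x (1 : ℂ))
      (boundaryRep E (expectation hE a) (lp.single 2 x (1 : ℂ)) : ℓ²(E.BoundaryPath, ℂ)) := rfl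

theorem norm_diagFunctional_le (hE : E.RowFinite) (x : E.BoundaryPath) (a : E.CStarAlg) :
    ‖diagFunctional hE x a‖ ≤ ‖a‖ := by
  classical
  have h1 : ‖(lp.single 2 x (1 : ℂ) : ℓ²(E.BoundaryPath, ℂ))‖ = 1 := by
    rw [lp.norm_single (by norm_num), norm_one]
  have h2 : ‖boundaryRep E (expectation hE a)‖ ≤ ‖expectation hE a‖ :=
    NonUnitalStarAlgHom.norm_apply_le _ _
  have h3 : ‖expectation hE a‖ ≤ ‖a‖ := by
    have := (expectation hE).le_of_opNorm_le
      (LinearMap.mkContinuous_norm_le _ zero_le_one _) a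
    rwa [one_mul] at this
  rw [diagFunctional_apply]
  refine (norm_inner_le_norm _ _).trans ?_
  rw [h1, one_mul]
  refine (ContinuousLinearMap.le_opNorm _ _).trans ?_
  rw [h1, mul_one]
  exact h2.trans h3

open scoped Classical in
theorem diagFunctional_monomial (hE : E.RowFinite) (x : E.BoundaryPath) (μ ν : List W) (v : V) :
    diagFunctional hE x ((univ E).path μ v * star ((univ E).path ν v))
      = if μ = ν ∧ x.StartsWith μ v then 1 else 0 := by
  rw [diagFunctional_apply, expectation_monomial]
  split_ifs with h1 h2 h2
  · rw [boundaryRep_monomial_diag h1, if_pos h2]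
  · rw [boundaryRep_monomial_diag h1, if_neg h2]
  · exact absurd (congrArg _ h2.1) h1
  · simp

theorem exists_expectation_eq_star_mul_self (hE : E.RowFinite) (a : E.CStarAlg) :
    ∃ d, expectation hE (star a * a) = star d * d := by
  let _ := CStarAlgebra.spectralOrder E.CStarAlg
  have _ := CStarAlgebra.spectralOrderedRing E.CStarAlg
  have hpi := Real.pi_pos
  refine CStarAlgebra.nonneg_iff_eq_star_mul_self.1 ?_
  rw [expectation_apply, intervalIntegral.integral_of_le (by linarith)]
  refine smul_nonneg (by positivity) (MeasureTheory.integral_nonneg fun t => ?_)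
  change 0 ≤ gauge E (Circle.exp t) (star a * a)
  rw [map_mul, map_star]
  exact star_mul_self_nonneg _

/-- The functionals `diagFunctional` are jointly faithful. -/
theorem exists_diagFunctional_ne_zero (hE : E.RowFinite) {a : E.CStarAlg} (ha : a ≠ 0) :
    ∃ x, diagFunctional hE x (star a * a) ≠ 0 := by
  classical
  by_contra! h
  obtain ⟨d, hd⟩ := exists_expectation_eq_star_mul_self hE a
  have h1 : boundaryRep E d = 0 := by
    refine clm_ext_single fun x => ?_
    have h2 := h x
    rw [diagFunctional_apply, hd, map_mul, map_star, ContinuousLinearMap.star_eq_adjoint] at h2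
    change inner ℂ _ (ContinuousLinearMap.adjoint (boundaryRep E d) (boundaryRep E d _)) = 0 at h2
    rw [ContinuousLinearMap.adjoint_inner_right, inner_self_eq_zero] at h2
    exact h2
  have h3 : ‖boundaryRep E (expectation hE (star a * a))‖ = ‖expectation hE (star a * a)‖ :=
    norm_map_of_mem_core hE _ (fun v => by
      change (boundaryFamily E).lift (p E v) ≠ 0
      rw [CKFamily.lift_p]
      exact boundaryFamily_P_ne_zero v) (expectation_mem hE _)
  rw [hd, map_mul, h1, mul_zero, norm_zero, ← hd] at h3
  exact ha (eq_zero_of_expectation_eq_zero hE (norm_eq_zero.1 h3.symm))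

theorem exists_mem_span_of_length_le (hE : E.RowFinite) {b : E.CStarAlg} (hb : b ∈ monomialSpan E) :
    ∃ M, b ∈ Submodule.span ℂ {x | ∃ μ ν v, μ.length ≤ M ∧ ν.length ≤ M ∧ E.IsPath μ v ∧
      E.IsPath ν v ∧ x = (univ E).path μ v * star ((univ E).path ν v)} := by
  have mono : ∀ M N : ℕ, M ≤ N → Submodule.span ℂ {x | ∃ μ ν v, μ.length ≤ M ∧ ν.length ≤ M ∧
      E.IsPath μ v ∧ E.IsPath ν v ∧ x = (univ E).path μ v * star ((univ E).path ν v)} ≤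
      Submodule.span ℂ {x | ∃ μ ν v, μ.length ≤ N ∧ ν.length ≤ N ∧
      E.IsPath μ v ∧ E.IsPath ν v ∧ x = (univ E).path μ v * star ((univ E).path ν v)} :=
    fun M N h => Submodule.span_mono fun _ ⟨μ, ν, v, h1, h2, h3⟩ =>
      ⟨μ, ν, v, h1.trans h, h2.trans h, h3⟩
  induction hb using Submodule.span_induction with
  | zero => exact ⟨0, zero_mem _⟩
  | add a b _ _ ha hb =>
    obtain ⟨M, hM⟩ := ha
    obtain ⟨N, hN⟩ := hb
    exact ⟨max M N, add_mem (mono _ _ (le_max_left _ _) hM) (mono _ _ (le_max_right _ _) hN)⟩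
  | smul c a _ ha =>
    obtain ⟨M, hM⟩ := ha
    exact ⟨M, Submodule.smul_mem _ c hM⟩
  | mem a ha =>
    obtain ⟨μ, ν, v, rfl⟩ := ha
    by_cases hμ : E.IsPath μ v
    · by_cases hν : E.IsPath ν v
      · exact ⟨max μ.length ν.length, Submodule.subset_span
          ⟨μ, ν, v, le_max_left _ _, le_max_right _ _, hμ, hν, rfl⟩⟩
      · rw [CKFamily.path_eq_zero _ hE hν, star_zero, mul_zero]; exact ⟨0, zero_mem _⟩
    · rw [CKFamily.path_eq_zero _ hE hμ, zero_mul]; exact ⟨0, zero_mem _⟩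

/-- Under condition (L) each element of the span of the monomials can be compressed to any of its
diagonal values. -/
theorem exists_compress (hE : E.RowFinite) (hL : E.ConditionL) (x : E.BoundaryPath)
    {b : E.CStarAlg} (hb : b ∈ monomialSpan E) :
    ∃ τ w, E.IsPath τ w ∧ star ((univ E).path τ w) * b * (univ E).path τ w
      = diagFunctional hE x b • (univ E).P w := by
  classical
  obtain ⟨M, hM⟩ := exists_mem_span_of_length_le hE hb
  obtain ⟨τ, w, h⟩ := (univ E).exists_separates hE hL x M
  refine ⟨τ, w, h.isPath, ?_⟩
  clear hb
  induction hM using Submodule.span_induction with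
  | zero => simp
  | add a b _ _ ha hb => rw [mul_add, add_mul, ha, hb, map_add, add_smul]
  | smul c a _ ha => rw [mul_smul_comm, smul_mul_assoc, ha, map_smul, smul_assoc]
  | mem a ha =>
    obtain ⟨μ, ν, v, hμ, hν, hμp, hνp, rfl⟩ := ha
    rw [h.compress hE hμ hν hμp hνp, diagFunctional_monomial]

end CStarAlg

theorem norm_projection_le_one {A : Type*} [NonUnitalCStarAlgebra A] {q : A} (hq : star q = q)
    (hqq : q * q = q) : ‖q‖ ≤ 1 := by
  have h := CStarRing.norm_star_mul_self (x := q)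
  rw [hq, hqq] at h
  nlinarith [norm_nonneg q]

/-- A projection at distance less than one from a closed ideal belongs to the ideal: in the corner
cut out by `q`, the projection is congruent modulo the ideal to all powers of the element
`q - q j q`, whose norm is less than one. -/
theorem mem_of_norm_sub_lt {A : Type*} [NonUnitalCStarAlgebra A] {J : Submodule ℂ A}
    (hJ : IsCStarIdeal J) {q j : A} (hq : star q = q) (hqq : q * q = q) (hj : j ∈ J)
    (h : ‖q - j‖ < 1) : q ∈ J := by
  have hq1 := norm_projection_le_one hq hqq
  set y := q * (q - j) * q with hy
  have hyn : ‖y‖ ≤ ‖q - j‖ := by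
    calc ‖y‖ ≤ ‖q‖ * ‖q - j‖ * ‖q‖ := norm_mul₃_le
      _ ≤ 1 * ‖q - j‖ * 1 := by gcongr
      _ = ‖q - j‖ := by rw [one_mul, mul_one]
  have hyq : y * q = y := by rw [hy, mul_assoc, hqq]
  let z : ℕ → A := fun n => (fun a => a * y)^[n] q
  have hz : ∀ n, z (n + 1) = z n * y := fun n => Function.iterate_succ_apply' _ _ _
  have hzq : ∀ n, z n * q = z n := by
    intro n
    cases n with
    | zero => exact hqq
    | succ n => rw [hz, mul_assoc, hyq]
  have hzJ : ∀ n, q - z n ∈ J := by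
    intro n
    induction n with
    | zero => exact (sub_self q).symm ▸ J.zero_mem
    | succ n ih =>
      have h1 : q - z (n + 1) = (q - z n) + z n * (q * j * q) := by
        have h2 : y = q - q * j * q := by rw [hy, mul_sub, sub_mul, hqq, hqq]
        rw [hz, h2, mul_sub, hzq]
        abel
      rw [h1]
      exact J.add_mem ih (hJ.mul_mem_left _ _ (hJ.mul_mem_right _ _ (hJ.mul_mem_left _ _ hj)))
  have hzn : ∀ n, ‖z n‖ ≤ ‖q - j‖ ^ n := by
    intro n
    induction n with
    | zero => rw [pow_zero]; exact hq1
    | succ n ih =>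
      rw [hz, pow_succ]
      exact (norm_mul_le _ _).trans (mul_le_mul ih hyn (norm_nonneg _) (by positivity))
  have hlim : Filter.Tendsto (fun n => q - z n) Filter.atTop (nhds (q - 0)) :=
    tendsto_const_nhds.sub (squeeze_zero_norm hzn
      (tendsto_pow_atTop_nhds_zero_of_lt_one (norm_nonneg _) h))
  rw [sub_zero] at hlim
  exact hJ.isClosed.mem_of_tendsto hlim (Filter.Eventually.of_forall hzJ)

theorem norm_path_le_one (hE : E.RowFinite) (τ : List W) (w : V) :
    ‖(CStarAlg.univ E).path τ w‖ ≤ 1 := by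
  by_cases h : E.IsPath τ w
  · have h1 := CStarRing.norm_star_mul_self (x := (CStarAlg.univ E).path τ w)
    rw [CKFamily.star_path_mul_path_self _ hE h] at h1
    have h2 := norm_projection_le_one ((CStarAlg.univ E).star_P w) ((CStarAlg.univ E).P_mul_self w)
    nlinarith [norm_nonneg ((CStarAlg.univ E).path τ w)]
  · rw [CKFamily.path_eq_zero _ hE h, norm_zero]
    exact zero_le_one

theorem hasIdealIntersectionProperty_of_conditionL (hE : E.RowFinite) (hL : E.ConditionL) :
    HasIdealIntersectionProperty (CStarAlg.diagonal E) := by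
  intro J hJ hne
  obtain ⟨a, haJ, ha⟩ := J.ne_bot_iff.1 hne
  obtain ⟨x, hx⟩ := CStarAlg.exists_diagFunctional_ne_zero hE ha
  have hbJ : star a * a ∈ J := hJ.mul_mem_left _ _ haJ
  set b := star a * a
  set r := ‖CStarAlg.diagFunctional hE x b‖ with hr
  have hrpos : 0 < r := norm_pos_iff.2 hx
  obtain ⟨b', hb', hbb'⟩ := Metric.mem_closure_iff.1 (CStarAlg.dense_monomialSpan hE b) (r / 2)
    (by positivity)
  rw [dist_eq_norm] at hbb'
  obtain ⟨τ, w, hτ, hcomp⟩ := CStarAlg.exists_compress hE hL x hb'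
  set c := CStarAlg.diagFunctional hE x b'
  set t := (CStarAlg.univ E).path τ w
  have hc : r / 2 < ‖c‖ := by
    have h1 := CStarAlg.norm_diagFunctional_le hE x (b - b')
    rw [map_sub] at h1
    have h2 := norm_sub_norm_le (CStarAlg.diagFunctional hE x b) c
    linarith
  have hc0 : c ≠ 0 := norm_pos_iff.1 (by linarith)
  -- `c⁻¹ • (star t * b * t)` is an element of the ideal at distance less than one from `p_w`
  have hw : (CStarAlg.univ E).P w ∈ J := by
    refine mem_of_norm_sub_lt hJ ((CStarAlg.univ E).star_P w) ((CStarAlg.univ E).P_mul_self w)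
      (j := c⁻¹ • (star t * b * t))
      (J.smul_mem _ (hJ.mul_mem_right _ _ (hJ.mul_mem_left _ _ hbJ))) ?_
    have h1 : (CStarAlg.univ E).P w - c⁻¹ • (star t * b * t) = c⁻¹ • (star t * (b' - b) * t) := by
      rw [mul_sub, sub_mul, hcomp, smul_sub, smul_smul, inv_mul_cancel₀ hc0, one_smul]
    have h2 : ‖star t * (b' - b) * t‖ ≤ ‖b - b'‖ := by
      have ht := norm_path_le_one hE τ w
      have hs : ‖star t‖ ≤ 1 := by rwa [norm_star]
      calc ‖star t * (b' - b) * t‖ ≤ ‖star t‖ * ‖b' - b‖ * ‖t‖ := norm_mul₃_le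
        _ ≤ 1 * ‖b' - b‖ * 1 := by gcongr
        _ = ‖b - b'‖ := by rw [one_mul, mul_one, norm_sub_rev]
    rw [h1, norm_smul, norm_inv, inv_mul_lt_iff₀ (by linarith), mul_one]
    linarith
  refine ⟨_, hw, ?_, CStarAlg.univ_P_ne_zero w⟩
  exact NonUnitalStarSubalgebra.le_topologicalClosure _
    (NonUnitalStarAlgebra.subset_adjoin ℂ _ (Or.inl ⟨w, rfl⟩))

end DirectedGraph

/-! ### Positive and negative parts -/

section PosPart

variable {A : Type*} [NonUnitalCStarAlgebra A]

theorem CFC.star_posPart (h : A) : star h⁺ = h⁺ := by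
  rw [CFC.posPart_def]
  exact (cfcₙ_predicate (R := ℝ) _ h).star_eq

theorem CFC.star_negPart (h : A) : star h⁻ = h⁻ := by
  rw [CFC.negPart_def]
  exact (cfcₙ_predicate (R := ℝ) _ h).star_eq

theorem NonUnitalStarAlgHom.map_negPart (φ : A →⋆ₙₐ[ℂ] A) {h : A}
    (hh : IsSelfAdjoint h) : φ h⁻ = (φ h)⁻ := by
  rw [CFC.negPart_def, CFC.negPart_def]
  exact NonUnitalStarAlgHomClass.map_cfcₙ φ _ h
    (hφ := continuous_nonUnitalStarAlgHom φ) (ha := hh) (hφa := hh.map φ)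

theorem NonUnitalStarAlgHom.map_posPart (φ : A →⋆ₙₐ[ℂ] A) {h : A}
    (hh : IsSelfAdjoint h) : φ h⁺ = (φ h)⁺ := by
  rw [← CFC.negPart_neg, NonUnitalStarAlgHom.map_negPart φ hh.neg, map_neg, CFC.negPart_neg]

end PosPart

/-! ### Annihilators -/

section Annihilators

variable {A : Type*} [NonUnitalCStarAlgebra A]

/-- The annihilator of a set as a linear subspace. -/
def annihilatorSubmodule (X : Set A) : Submodule ℂ A where
  carrier := annihilatorPerp X
  add_mem' {a b} ha hb x hx := by
    rw [add_mul, mul_add, (ha x hx).1, (ha x hx).2, (hb x hx).1, (hb x hx).2, add_zero]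
    exact ⟨rfl, rfl⟩
  zero_mem' x _ := ⟨zero_mul x, mul_zero x⟩
  smul_mem' c a ha x hx := by
    rw [smul_mul_assoc, mul_smul_comm, (ha x hx).1, (ha x hx).2, smul_zero]
    exact ⟨rfl, rfl⟩

/-- A set which is stable under multiplication by elements of the algebra on both sides. -/
def IsMulStable (X : Set A) : Prop := ∀ a, ∀ x ∈ X, a * x ∈ X ∧ x * a ∈ X

theorem IsMulStable.annihilatorPerp {X : Set A} (hX : IsMulStable X) :
    IsMulStable (annihilatorPerp X) := by
  intro b a ha
  refine ⟨fun x hx => ⟨?_, ?_⟩, fun x hx => ⟨?_, ?_⟩⟩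
  · rw [mul_assoc, (ha x hx).1, mul_zero]
  · rw [← mul_assoc, (ha _ (hX b x hx).2).2]
  · rw [mul_assoc, (ha _ (hX b x hx).1).1]
  · rw [← mul_assoc, (ha x hx).2, zero_mul]

theorem star_mem_annihilatorPerp {X : Set A} (hX : ∀ x ∈ X, star x ∈ X) {a : A}
    (ha : a ∈ annihilatorPerp X) : star a ∈ annihilatorPerp X := by
  intro x hx
  have h := ha _ (hX x hx)
  refine ⟨?_, ?_⟩
  · rw [← star_star x, ← star_mul, h.2, star_zero]
  · rw [← star_star x, ← star_mul, h.1, star_zero]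

theorem subset_annihilatorPerp_annihilatorPerp (X : Set A) :
    X ⊆ annihilatorPerp (annihilatorPerp X) :=
  fun x hx _ ha => ⟨(ha x hx).2, (ha x hx).1⟩

theorem annihilatorPerp_anti {X Y : Set A} (h : X ⊆ Y) : annihilatorPerp Y ⊆ annihilatorPerp X :=
  fun _ ha x hx => ha x (h hx)

theorem isClosed_annihilatorPerp (X : Set A) : IsClosed (annihilatorPerp X) := by
  have h : annihilatorPerp X = ⋂ x ∈ X, ({a | a * x = 0} ∩ {a | x * a = 0}) := by
    ext a
    simp [annihilatorPerp]
  rw [h]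
  exact isClosed_biInter fun x _ =>
    (isClosed_eq (by fun_prop) continuous_const).inter (isClosed_eq (by fun_prop) continuous_const)

theorem IsMulStable.isRegularIdeal {X : Set A} (hX : IsMulStable X) :
    IsRegularIdeal (annihilatorSubmodule X) where
  left := ⟨isClosed_annihilatorPerp X, fun a x hx => (hX.annihilatorPerp a x hx).1,
    fun a x hx => (hX.annihilatorPerp a x hx).2⟩
  right := (subset_annihilatorPerp_annihilatorPerp _).antisymm
    (annihilatorPerp_anti (subset_annihilatorPerp_annihilatorPerp X))

theorem isMulStable_mul_mul (q : A) : IsMulStable {x | ∃ a b, x = a * q * b} := by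
  rintro c _ ⟨a, b, rfl⟩
  exact ⟨⟨c * a, b, by simp only [mul_assoc]⟩, ⟨a, b * c, by simp only [mul_assoc]⟩⟩

theorem star_mem_mul_mul {q : A} (hq : star q = q) {x : A} (hx : x ∈ {x | ∃ a b, x = a * q * b}) :
    star x ∈ {x | ∃ a b, x = a * q * b} := by
  obtain ⟨a, b, rfl⟩ := hx
  exact ⟨star b, star a, by rw [star_mul, star_mul, hq, mul_assoc]⟩

theorem IsMulStable.union {X Y : Set A} (hX : IsMulStable X) (hY : IsMulStable Y) :
    IsMulStable (X ∪ Y) := by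
  rintro a x (hx | hx)
  · exact ⟨.inl (hX a x hx).1, .inl (hX a x hx).2⟩
  · exact ⟨.inr (hY a x hx).1, .inr (hY a x hx).2⟩

end Annihilators

/-! ### Cycles without entry -/

namespace DirectedGraph

variable {V W : Type*} {E : DirectedGraph V W}

/-- A cycle without entry, as a periodic sequence of edges: each edge of the cycle is the only edge
with its range. -/
structure EntrylessCycle (E : DirectedGraph V W) where
  /-- the length of the cycle -/
  m : ℕ
  /-- the edges of the cycle -/
  c : ℕ → W
  m_pos : 0 < m
  chain : ∀ k, E.r (c (k + 1)) = E.s (c k)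
  periodic : ∀ k, c (k + m) = c k
  eq_of_range : ∀ k f, E.r f = E.r (c k) → f = c k

theorem exists_entrylessCycle (h : ¬ E.ConditionL) : Nonempty E.EntrylessCycle := by
  unfold ConditionL at h
  push Not at h
  obtain ⟨n, e, ⟨h1, h2⟩, h3⟩ := h
  refine ⟨⟨n + 1, fun k => e ⟨k % (n + 1), Nat.mod_lt _ n.succ_pos⟩, n.succ_pos, fun k => ?_,
    fun k => by simp, fun k f hf => ?_⟩⟩
  · have hk : k % (n + 1) < n + 1 := Nat.mod_lt k n.succ_pos
    rcases (Nat.lt_succ_iff.1 hk).lt_or_eq with hlt | heq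
    · have h4 : (k + 1) % (n + 1) = k % (n + 1) + 1 := by
        rw [Nat.add_mod, Nat.mod_eq_of_lt]
        · rw [Nat.mod_eq_of_lt (show 1 < n + 1 by omega)]
        · rw [Nat.mod_eq_of_lt (show 1 < n + 1 by omega)]; omega
      have := h1 ⟨k % (n + 1), hlt⟩
      simp only [h4]
      exact this
    · have h4 : (k + 1) % (n + 1) = 0 := by
        rw [← Nat.mod_add_mod, heq, Nat.mod_self]
      simp only [h4, heq]
      exact h2
  · by_contra hne
    have hmem : f ∈ {f | E.r f = E.r (e ⟨k % (n + 1), Nat.mod_lt _ n.succ_pos⟩)} \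
        {e ⟨k % (n + 1), Nat.mod_lt _ n.succ_pos⟩} := ⟨hf, hne⟩
    rw [h3] at hmem
    exact hmem

namespace EntrylessCycle

variable (C : E.EntrylessCycle)

/-- The vertices of the cycle. -/
def vertex (k : ℕ) : V := E.r (C.c k)

/-- The path of length `l` along the cycle with range the vertex of index `k`. -/
def seg : ℕ → ℕ → List W
  | _, 0 => []
  | k, l + 1 => C.c k :: seg (k + 1) l

theorem length_seg (k l : ℕ) : (C.seg k l).length = l := by
  induction l generalizing k with
  | zero => rfl
  | succ l ih => rw [seg, List.length_cons, ih]

theorem seg_add (k l l' : ℕ) : C.seg k (l + l') = C.seg k l ++ C.seg (k + l) l' := by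
  induction l generalizing k with
  | zero => simp [seg]
  | succ l ih => rw [Nat.add_right_comm, seg, ih, seg, List.cons_append, Nat.add_right_comm k 1 l,
      add_assoc k l 1]

theorem rangeOf_seg (k l : ℕ) : E.rangeOf (C.seg k l) (C.vertex (k + l)) = C.vertex k := by
  cases l <;> rfl

theorem isPath_seg (k l : ℕ) : E.IsPath (C.seg k l) (C.vertex (k + l)) := by
  induction l generalizing k with
  | zero => trivial
  | succ l ih =>
    have h := ih (k + 1)
    rw [show k + 1 + l = k + (l + 1) by omega] at h
    refine ⟨?_, h⟩
    have h2 := C.rangeOf_seg (k + 1) l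
    rw [show k + 1 + l = k + (l + 1) by omega] at h2
    rw [h2]
    exact (C.chain k).symm

/-- The only paths whose range is on the cycle are the paths along the cycle. -/
theorem eq_seg {μ : List W} {u : V} {k : ℕ} (h : E.IsPath μ u) (hr : E.rangeOf μ u = C.vertex k) :
    μ = C.seg k μ.length ∧ u = C.vertex (k + μ.length) := by
  induction μ generalizing k with
  | nil => exact ⟨rfl, hr⟩
  | cons e μ ih =>
    obtain rfl := C.eq_of_range k e hr
    obtain ⟨h1, h2⟩ := ih (k := k + 1) h.2 (h.1.symm.trans (C.chain k).symm)
    refine ⟨?_, ?_⟩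
    · rw [List.length_cons, seg, ← h1]
    · rw [h2, List.length_cons]
      congr 1
      omega

theorem vertex_add_m (k : ℕ) : C.vertex (k + C.m) = C.vertex k := by
  rw [vertex, C.periodic, vertex]

theorem vertex_mul_m (k : ℕ) : C.vertex (k * C.m) = C.vertex 0 := by
  induction k with
  | zero => rw [zero_mul]
  | succ k ih => rw [Nat.succ_mul, vertex_add_m, ih]

theorem seg_eq_of_vertex_eq {j k : ℕ} (h : C.vertex j = C.vertex k) (l : ℕ) :
    C.seg j l = C.seg k l ∧ C.vertex (j + l) = C.vertex (k + l) := by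
  have := C.eq_seg (C.isPath_seg j l) ((C.rangeOf_seg j l).trans h)
  rwa [length_seg] at this

open CStarAlg

/-- The element of `C*(E)` attached to a path along the cycle. -/
def elt (k l : ℕ) : E.CStarAlg := (univ E).path (C.seg k l) (C.vertex (k + l))

theorem elt_eq_of_vertex_eq {j k : ℕ} (h : C.vertex j = C.vertex k) (l : ℕ) :
    C.elt j l = C.elt k l := by
  rw [elt, (C.seg_eq_of_vertex_eq h l).1, (C.seg_eq_of_vertex_eq h l).2, elt]

theorem elt_add (hE : E.RowFinite) (k l l' : ℕ) :
    C.elt k (l + l') = C.elt k l * C.elt (k + l) l' := by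
  rw [elt, seg_add, CKFamily.path_append _ hE, ← add_assoc, rangeOf_seg]
  rfl

theorem star_elt_mul_elt (hE : E.RowFinite) (k l : ℕ) :
    star (C.elt k l) * C.elt k l = (univ E).P (C.vertex (k + l)) :=
  CKFamily.star_path_mul_path_self _ hE (C.isPath_seg k l)

theorem elt_mul_star_elt (hE : E.RowFinite) (k l : ℕ) :
    C.elt k l * star (C.elt k l) = (univ E).P (C.vertex k) := by
  induction l generalizing k with
  | zero =>
    change (univ E).P _ * star ((univ E).P _) = _
    rw [(univ E).star_P, (univ E).P_mul_self, add_zero]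
  | succ l ih =>
    have h1 : C.elt k (l + 1) = (univ E).S (C.c k) * C.elt (k + 1) l := by
      rw [elt, elt, show k + 1 + l = k + (l + 1) by omega]
      rfl
    have h2 : (hE (C.vertex k)).toFinset = {C.c k} := by
      ext f
      simp only [Set.Finite.mem_toFinset, Finset.mem_singleton]
      exact ⟨fun hf => C.eq_of_range k f hf, fun hf => by rw [hf]; rfl⟩
    have h3 := (univ E).P_eq_sum (C.vertex k) (hE _) ⟨C.c k, rfl⟩
    rw [h2, Finset.sum_singleton] at h3
    rw [h1, star_mul, mul_assoc, ← mul_assoc (C.elt _ _), ih, vertex, C.chain, ← mul_assoc,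
      CKFamily.S_mul_P, h3]

theorem P_mul_elt (hE : E.RowFinite) (k l : ℕ) :
    (univ E).P (C.vertex k) * C.elt k l = C.elt k l := by
  have := CKFamily.P_mul_path (univ E) hE (C.seg k l) (C.vertex (k + l))
  rwa [rangeOf_seg] at this

/-- Once around the cycle, from the vertex of index `k` to itself. -/
def loop (k : ℕ) : E.CStarAlg := C.elt k C.m

theorem loop_mul_elt (hE : E.RowFinite) (k l : ℕ) :
    C.loop k * C.elt k l = C.elt k l * C.loop (k + l) := by
  rw [loop, loop, ← C.elt_add hE, ← C.elt_eq_of_vertex_eq (C.vertex_add_m k) l, ← C.elt_add hE,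
    add_comm]

theorem loop_mul_P (k : ℕ) : C.loop k * (univ E).P (C.vertex k) = C.loop k := by
  rw [loop, elt, vertex_add_m, CKFamily.path_mul_P]

theorem star_elt_mul_loop (hE : E.RowFinite) (k l : ℕ) :
    star (C.elt k l) * C.loop k = C.loop (k + l) * star (C.elt k l) := by
  calc star (C.elt k l) * C.loop k
      = star (C.elt k l) * (C.loop k * C.elt k l) * star (C.elt k l) := by
        rw [mul_assoc, mul_assoc (C.loop k), C.elt_mul_star_elt hE, loop_mul_P]
    _ = C.loop (k + l) * star (C.elt k l) := by
        rw [C.loop_mul_elt hE, ← mul_assoc, C.star_elt_mul_elt hE]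
        rw [loop, C.P_mul_elt hE]

/-- The loop commutes with the corner at the base vertex. -/
theorem commute_loop (hE : E.RowFinite) (a : E.CStarAlg) :
    Commute (C.loop 0) ((univ E).P (C.vertex 0) * a * (univ E).P (C.vertex 0)) := by
  set q := (univ E).P (C.vertex 0)
  have hq : star q = q := (univ E).star_P _
  let K : Submodule ℂ E.CStarAlg :=
    { carrier := {a | C.loop 0 * (q * a * q) = q * a * q * C.loop 0}
      add_mem' := fun {a b} ha hb => by
        change C.loop 0 * (q * (a + b) * q) = q * (a + b) * q * C.loop 0
        rw [mul_add, add_mul, mul_add, add_mul]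
        exact congrArg₂ _ ha hb
      zero_mem' := by
        change C.loop 0 * (q * 0 * q) = q * 0 * q * C.loop 0
        simp only [mul_zero, zero_mul]
      smul_mem' := fun c a ha => by
        change C.loop 0 * (q * (c • a) * q) = q * (c • a) * q * C.loop 0
        rw [mul_smul_comm, smul_mul_assoc, mul_smul_comm, smul_mul_assoc]
        exact congrArg _ ha }
  have h : Continuous fun a => q * a * q :=
    (continuous_const.mul continuous_id).mul continuous_const
  have hK : IsClosed (K : Set E.CStarAlg) :=
    isClosed_eq (continuous_const.mul h) (h.mul continuous_const)
  refine monomial_induction hE K hK (fun μ ν v hμ hν => ?_) a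
  change C.loop 0 * (q * _ * q) = q * _ * q * C.loop 0
  by_cases h1 : E.rangeOf μ v = C.vertex 0
  · by_cases h2 : E.rangeOf ν v = C.vertex 0
    · obtain ⟨hμ1, hμ2⟩ := C.eq_seg hμ h1
      obtain ⟨hν1, hν2⟩ := C.eq_seg hν h2
      have h3 : (univ E).path μ v = C.elt 0 μ.length := by rw [elt, ← hμ1, ← hμ2]
      have h4 : (univ E).path ν v = C.elt 0 ν.length := by rw [elt, ← hν1, ← hν2]
      have h5 : q * C.elt 0 μ.length = C.elt 0 μ.length := C.P_mul_elt hE 0 _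
      have h6 : star (C.elt 0 ν.length) * q = star (C.elt 0 ν.length) := by
        rw [← hq, ← star_mul]
        exact congrArg star (C.P_mul_elt hE 0 _)
      have h7 : C.loop (0 + μ.length) = C.loop (0 + ν.length) :=
        C.elt_eq_of_vertex_eq (hμ2.symm.trans hν2) _
      rw [h3, h4, ← mul_assoc q, h5, mul_assoc, h6, ← mul_assoc, C.loop_mul_elt hE, h7, mul_assoc,
        ← C.star_elt_mul_loop hE, mul_assoc]
    · have h3 : star ((univ E).path ν v) * q = 0 := by
        rw [← hq, ← star_mul]
        exact (congrArg star (CKFamily.P_mul_path_of_ne _ hE _ _ (Ne.symm h2))).trans (star_zero _)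
      rw [mul_assoc q, mul_assoc _ _ q, h3, mul_zero, mul_zero, mul_zero, zero_mul]
  · rw [← mul_assoc q, CKFamily.P_mul_path_of_ne _ hE _ _ (Ne.symm h1)]
    simp only [zero_mul, mul_zero]

/-- The real part of the loop, up to a factor. -/
def re : E.CStarAlg := C.loop 0 + star (C.loop 0)

theorem isSelfAdjoint_re : IsSelfAdjoint C.re := by
  rw [IsSelfAdjoint, re, star_add, star_star, add_comm]

theorem commute_re (hE : E.RowFinite) (a : E.CStarAlg) :
    Commute C.re ((univ E).P (C.vertex 0) * a * (univ E).P (C.vertex 0)) := by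
  have h := (C.commute_loop hE (star a)).star_star
  rw [star_mul, star_mul, star_star, (univ E).star_P, ← mul_assoc] at h
  exact (C.commute_loop hE a).add_left h

theorem P_mul_re (hE : E.RowFinite) : (univ E).P (C.vertex 0) * C.re = C.re := by
  have h := congrArg star (C.loop_mul_P 0)
  rw [star_mul, (univ E).star_P] at h
  rw [re, mul_add, h]
  rw [loop, C.P_mul_elt hE]

theorem re_mul_P (hE : E.RowFinite) : C.re * (univ E).P (C.vertex 0) = C.re := by
  have h := congrArg star (C.P_mul_re hE)
  rwa [star_mul, (univ E).star_P, C.isSelfAdjoint_re.star_eq] at h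

theorem gauge_loop (z : Circle) : gauge E z (C.loop 0) = (z : ℂ) ^ C.m • C.loop 0 := by
  rw [loop, elt, gauge_path, length_seg]

/-- Some element `z` of the circle, with `z ^ m = -1` where `m` is the length of the cycle, changes
the sign of the real part of the loop. -/
theorem exists_gauge_re : ∃ z : Circle, gauge E z C.re = -C.re := by
  have hm : (C.m : ℂ) ≠ 0 := by exact_mod_cast C.m_pos.ne'
  refine ⟨Circle.exp (Real.pi / C.m), ?_⟩
  have h : ((Circle.exp (Real.pi / C.m) : Circle) : ℂ) ^ C.m = -1 := by
    rw [Circle.coe_exp, ← Complex.exp_nat_mul, ← Complex.exp_pi_mul_I]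
    congr 1
    push_cast
    field_simp
  rw [re, map_add, map_star, gauge_loop, h]
  simp [add_comm]

theorem loop_ne_zero (hE : E.RowFinite) : C.loop 0 ≠ 0 := by
  intro h
  have h1 := C.star_elt_mul_elt hE 0 C.m
  rw [show C.elt 0 C.m = 0 from h, mul_zero] at h1
  exact univ_P_ne_zero _ h1.symm

/-- If the real part of the loop vanished, so would its image under an element of the circle which
multiplies the loop by `i`; but that image is the imaginary part of the loop, up to a factor. -/
theorem re_ne_zero (hE : E.RowFinite) : C.re ≠ 0 := by
  intro h0
  have hm : (C.m : ℂ) ≠ 0 := by exact_mod_cast C.m_pos.ne'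
  have h : ((Circle.exp (Real.pi / 2 / C.m) : Circle) : ℂ) ^ C.m = Complex.I := by
    have h1 : (C.m : ℂ) * (((Real.pi / 2 / C.m : ℝ) : ℂ) * Complex.I)
        = Real.pi / 2 * Complex.I := by
      push_cast
      field_simp
    rw [Circle.coe_exp, ← Complex.exp_nat_mul, h1, Complex.exp_pi_div_two_mul_I]
  have h1 := congrArg (gauge E (Circle.exp (Real.pi / 2 / C.m))) h0
  rw [re, map_add, map_star, gauge_loop, h, map_zero, star_smul] at h1
  rw [re] at h0
  have h2 : star (C.loop 0) = -C.loop 0 := by rw [eq_neg_iff_add_eq_zero, add_comm, h0]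
  rw [h2] at h1
  have h3 : (2 * Complex.I) • C.loop 0 = 0 := by
    rw [← h1, smul_neg]
    simp [two_mul, add_smul]
  exact C.loop_ne_zero hE ((smul_eq_zero.1 h3).resolve_left (by simp))

end EntrylessCycle
end DirectedGraph

/-! ### A regular ideal which misses the diagonal -/

namespace DirectedGraph

variable {V W : Type*} {E : DirectedGraph V W}

open CStarAlg

theorem CStarAlg.sPath_eq_path (e : W) (l : List W) :
    ∃ v, sPath E e l = (univ E).path (e :: l) v := by
  induction l generalizing e with
  | nil => exact ⟨E.s e, ((univ E).S_mul_P e).symm⟩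
  | cons f l ih =>
    obtain ⟨v, hv⟩ := ih f
    exact ⟨v, congrArg (s E e * ·) hv⟩

namespace EntrylessCycle

variable (C : E.EntrylessCycle)

/-- Range projections of paths act as scalars on a path which starts on the cycle, because such a
path can be extended in one way only. -/
theorem range_projection_mul_path (hE : E.RowFinite) (ν : List W) (u : V) {μ : List W}
    (hμ : E.IsPath μ (C.vertex 0)) :
    (univ E).path ν u * star ((univ E).path ν u) * (univ E).path μ (C.vertex 0) = 0 ∨
    (univ E).path ν u * star ((univ E).path ν u) * (univ E).path μ (C.vertex 0)
      = (univ E).path μ (C.vertex 0) := by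
  by_cases hν : E.IsPath ν u
  swap
  · rw [CKFamily.path_eq_zero _ hE hν, zero_mul, zero_mul]
    exact .inl rfl
  by_cases h1 : ν <+: μ
  · obtain ⟨α, rfl⟩ := h1
    by_cases hr : E.rangeOf α (C.vertex 0) = u
    · right
      rw [mul_assoc, CKFamily.star_path_mul_path_append _ hE α _ hν hr,
        CKFamily.path_append _ hE, hr]
    · left
      rw [mul_assoc, CKFamily.star_path_mul_path_of_ne_vertex _ hE α ν hr, mul_zero]
  · by_cases h2 : μ <+: ν
    · obtain ⟨α, rfl⟩ := h2
      by_cases hr : E.rangeOf α u = C.vertex 0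
      · right
        have hα := ((isPath_append _ _ _).1 hν).2
        obtain ⟨h3, h4⟩ := C.eq_seg hα hr
        have h5 : (univ E).path α u = C.elt 0 α.length := by rw [elt, ← h3, ← h4]
        rw [CKFamily.path_append _ hE, hr, star_mul, mul_assoc ((univ E).path μ _),
          ← mul_assoc ((univ E).path α u), h5, C.elt_mul_star_elt hE, CKFamily.P_mul_star_path,
          mul_assoc, CKFamily.star_path_mul_path_self _ hE hμ, CKFamily.path_mul_P]
      · left
        rw [mul_assoc, CKFamily.star_path_append_mul_path_of_ne _ hE α μ hr, mul_zero]
    · left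
      rw [mul_assoc, CKFamily.star_path_mul_path_of_not_prefix _ hE _ _ h1 h2, mul_zero]

/-- The elements of the diagonal act as scalars on the paths which start on the cycle. -/
theorem diagonal_mul_path_mem (hE : E.RowFinite) {d : E.CStarAlg} (hd : d ∈ diagonal E)
    {μ : List W} (hμ : E.IsPath μ (C.vertex 0)) :
    d * (univ E).path μ (C.vertex 0) ∈ Submodule.span ℂ {(univ E).path μ (C.vertex 0)} := by
  set t := (univ E).path μ (C.vertex 0) with ht
  let L := Submodule.span ℂ {t}
  let K : Set E.CStarAlg := {d | d * t ∈ L ∧ star d * t ∈ L}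
  have hL : IsClosed (L : Set E.CStarAlg) := Submodule.closed_of_finiteDimensional L
  have hK : IsClosed K :=
    (hL.preimage (continuous_mul_const t)).inter
      (hL.preimage ((continuous_mul_const t).comp continuous_star))
  have hLmul : ∀ {a b : E.CStarAlg}, a * t ∈ L → b * t ∈ L → a * b * t ∈ L := by
    intro a b ha hb
    obtain ⟨r, hr⟩ := Submodule.mem_span_singleton.1 hb
    rw [mul_assoc, ← hr, mul_smul_comm]
    exact L.smul_mem r ha
  have hproj : ∀ ν u, (univ E).path ν u * star ((univ E).path ν u) ∈ K := by
    intro ν u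
    have h : (univ E).path ν u * star ((univ E).path ν u) * t ∈ L := by
      rcases C.range_projection_mul_path hE ν u hμ with h | h
      · rw [← ht] at h
        rw [h]
        exact L.zero_mem
      · rw [← ht] at h
        rw [h]
        exact Submodule.mem_span_singleton_self t
    refine ⟨h, ?_⟩
    rwa [star_mul, star_star]
  have hadj : ∀ x ∈ NonUnitalStarAlgebra.adjoin ℂ (Set.range (p E) ∪
      {x | ∃ (e : W) (l : List W), x = sPath E e l * star (sPath E e l)}), x ∈ K := by
    intro x hx
    induction hx using NonUnitalStarAlgebra.adjoin_induction with
    | mem x hx =>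
      rcases hx with ⟨v, rfl⟩ | ⟨e, l, rfl⟩
      · have h := hproj [] v
        rwa [CKFamily.path_nil, (univ E).star_P, (univ E).P_mul_self] at h
      · obtain ⟨v, hv⟩ := sPath_eq_path (E := E) e l
        rw [hv]
        exact hproj _ _
    | add x y _ _ hx hy =>
      refine ⟨?_, ?_⟩
      · rw [add_mul]; exact L.add_mem hx.1 hy.1
      · rw [star_add, add_mul]; exact L.add_mem hx.2 hy.2
    | zero =>
      exact ⟨by rw [zero_mul]; exact L.zero_mem, by rw [star_zero, zero_mul]; exact L.zero_mem⟩
    | mul x y _ _ hx hy =>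
      exact ⟨hLmul hx.1 hy.1, by rw [star_mul]; exact hLmul hy.2 hx.2⟩
    | smul r x _ hx =>
      refine ⟨?_, ?_⟩
      · rw [smul_mul_assoc]; exact L.smul_mem _ hx.1
      · rw [star_smul, smul_mul_assoc]; exact L.smul_mem _ hx.2
    | star x _ hx => exact ⟨hx.2, by rw [star_star]; exact hx.1⟩
  exact (hK.closure_subset_iff.2 hadj hd).1

/-- An element which annihilates all paths starting on the cycle annihilates the ideal generated by
the base vertex of the cycle. -/
theorem mul_mul_P_eq_zero (hE : E.RowFinite) {d : E.CStarAlg}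
    (hd : ∀ μ, E.IsPath μ (C.vertex 0) → d * (univ E).path μ (C.vertex 0) = 0) (a : E.CStarAlg) :
    d * a * (univ E).P (C.vertex 0) = 0 := by
  set q := (univ E).P (C.vertex 0) with hq
  have hqs : star q = q := (univ E).star_P _
  let K : Submodule ℂ E.CStarAlg :=
    { carrier := {a | d * a * q = 0}
      add_mem' := fun {a b} ha hb => by
        change d * (a + b) * q = 0
        rw [mul_add, add_mul, show d * a * q = 0 from ha, show d * b * q = 0 from hb, add_zero]
      zero_mem' := by
        change d * 0 * q = 0
        rw [mul_zero, zero_mul]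
      smul_mem' := fun c a ha => by
        change d * (c • a) * q = 0
        rw [mul_smul_comm, smul_mul_assoc, show d * a * q = 0 from ha, smul_zero] }
  have hK : IsClosed (K : Set E.CStarAlg) :=
    isClosed_eq ((continuous_const.mul continuous_id).mul continuous_const) continuous_const
  refine monomial_induction hE K hK (fun μ ν u hμ hν => ?_) a
  change d * _ * q = 0
  by_cases h2 : E.rangeOf ν u = C.vertex 0
  · obtain ⟨hν1, hν2⟩ := C.eq_seg hν h2
    -- complete the path `ν` to a multiple of the cycle
    set b := ν.length
    set l := b * (C.m - 1) with hl
    have hbl : b + l = b * C.m := by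
      obtain ⟨m', hm'⟩ : ∃ m', C.m = m' + 1 := ⟨C.m - 1, by have := C.m_pos; omega⟩
      rw [hl, hm', Nat.add_sub_cancel]
      ring
    have hv : C.vertex (b + l) = C.vertex 0 := by rw [hbl, vertex_mul_m]
    have hu : u = C.vertex b := by rw [hν2, zero_add]
    have hP : (univ E).P u = C.elt b l * star (C.elt b l) := by rw [C.elt_mul_star_elt hE, hu]
    have hr : E.rangeOf (C.seg b l) (C.vertex 0) = u := by rw [← hv, rangeOf_seg, hu]
    have hpath : (univ E).path μ u * C.elt b l = (univ E).path (μ ++ C.seg b l) (C.vertex 0) := by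
      rw [CKFamily.path_append _ hE, hr, elt, hv]
    have hip : E.IsPath (μ ++ C.seg b l) (C.vertex 0) := by
      rw [isPath_append, hr]
      refine ⟨hμ, ?_⟩
      have := C.isPath_seg b l
      rwa [hv] at this
    rw [← CKFamily.path_mul_P, hP, ← mul_assoc ((univ E).path μ u), hpath,
      ← mul_assoc, ← mul_assoc, hd _ hip, zero_mul,
      zero_mul, zero_mul]
  · have h3 : star ((univ E).path ν u) * q = 0 := by
      rw [← hqs, ← star_mul]
      exact (congrArg star (CKFamily.P_mul_path_of_ne _ hE _ _ (Ne.symm h2))).trans (star_zero _)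
    rw [← mul_assoc d, mul_assoc, h3, mul_zero]

/-- The gauge action exchanges the positive and the negative part of the real part of the loop, so
neither of them vanishes. -/
theorem posPart_ne_zero_and_negPart_ne_zero (hE : E.RowFinite) : C.re⁺ ≠ 0 ∧ C.re⁻ ≠ 0 := by
  obtain ⟨z, hz⟩ := C.exists_gauge_re
  have h1 : gauge E z C.re⁺ = C.re⁻ := by
    rw [NonUnitalStarAlgHom.map_posPart _ C.isSelfAdjoint_re, hz, CFC.posPart_neg]
  have h2 : gauge E z C.re⁻ = C.re⁺ := by
    rw [NonUnitalStarAlgHom.map_negPart _ C.isSelfAdjoint_re, hz, CFC.negPart_neg]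
  have h3 := CFC.posPart_sub_negPart C.re C.isSelfAdjoint_re
  refine ⟨fun h => ?_, fun h => ?_⟩
  · rw [h, map_zero] at h1
    rw [h, ← h1, sub_zero] at h3
    exact C.re_ne_zero hE h3.symm
  · rw [h, map_zero] at h2
    rw [h, ← h2, sub_zero] at h3
    exact C.re_ne_zero hE h3.symm

/-- Two non-zero elements `f, g` of the corner at the base vertex with `f g = 0`, such that `f`
commutes with the corner: the squares of the positive and the negative part of the real part of the
loop. -/
theorem exists_orthogonal (hE : E.RowFinite) : ∃ f g : E.CStarAlg, f ≠ 0 ∧ g ≠ 0 ∧ star g = g ∧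
    f * g = 0 ∧ g * f = 0 ∧
    (univ E).P (C.vertex 0) * f = f ∧ f * (univ E).P (C.vertex 0) = f ∧
    (univ E).P (C.vertex 0) * g = g ∧ g * (univ E).P (C.vertex 0) = g ∧
    ∀ a, Commute f ((univ E).P (C.vertex 0) * a * (univ E).P (C.vertex 0)) := by
  obtain ⟨hf, hg⟩ := C.posPart_ne_zero_and_negPart_ne_zero hE
  have hpn := CFC.posPart_mul_negPart C.re
  have hnp := CFC.negPart_mul_posPart C.re
  have hsub := CFC.posPart_sub_negPart C.re C.isSelfAdjoint_re
  have hP := C.P_mul_re hE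
  have hP' := C.re_mul_P hE
  set F := C.re⁺ with hF
  set G := C.re⁻ with hG
  have hFs : star F = F := CFC.star_posPart _
  have hGs : star G = G := CFC.star_negPart _
  have hF1 : C.re * F = F * F := by rw [← hsub, sub_mul, hnp, sub_zero]
  have hF2 : F * C.re = F * F := by rw [← hsub, mul_sub, hpn, sub_zero]
  have hG1 : C.re * G = -(G * G) := by rw [← hsub, sub_mul, hpn, zero_sub]
  have hG2 : G * C.re = -(G * G) := by rw [← hsub, mul_sub, hnp, zero_sub]
  have hG1' : G * G = -(C.re * G) := by rw [hG1, neg_neg]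
  have hG2' : G * G = -(G * C.re) := by rw [hG2, neg_neg]
  refine ⟨F * F, G * G, ?_, ?_, by rw [star_mul, hGs], ?_, ?_, ?_, ?_, ?_, ?_, fun a => ?_⟩
  · intro h
    rw [← hFs] at h
    nth_rw 2 [hFs] at h
    exact hf ((CStarRing.star_mul_self_eq_zero_iff _).1 h)
  · intro h
    rw [← hGs] at h
    nth_rw 2 [hGs] at h
    exact hg ((CStarRing.star_mul_self_eq_zero_iff _).1 h)
  · rw [mul_assoc, ← mul_assoc F G, hpn, zero_mul, mul_zero]
  · rw [mul_assoc, ← mul_assoc G F, hnp, zero_mul, mul_zero]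
  · rw [← hF1, ← mul_assoc, hP]
  · rw [← hF2, mul_assoc, hP']
  · rw [hG1', mul_neg, ← mul_assoc, hP]
  · rw [hG2', neg_mul, mul_assoc, hP']
  · have h : Commute F _ := (C.commute_re hE a).cfcₙ_real (·⁺)
    exact h.mul_left h

end EntrylessCycle

theorem conditionL_of_hasRegularIdealIntersectionProperty (hE : E.RowFinite)
    (h : HasRegularIdealIntersectionProperty (diagonal E)) : E.ConditionL := by
  by_contra hL
  obtain ⟨C⟩ := exists_entrylessCycle hL
  obtain ⟨f, g, hf, hg, hgs, hfg, hgf, hqf, hfq, hqg, hgq, hcomm⟩ := C.exists_orthogonal hE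
  set q := (univ E).P (C.vertex 0) with hq
  have hqs : star q = q := (univ E).star_P _
  set I : Set E.CStarAlg := {x | ∃ a b, x = a * q * b}
  set K : Set E.CStarAlg := {x | ∃ a b, x = a * g * b}
  set Y : Set E.CStarAlg := annihilatorPerp I
  have hY : IsMulStable Y := (isMulStable_mul_mul q).annihilatorPerp
  have hX : IsMulStable (K ∪ Y) := (isMulStable_mul_mul g).union hY
  have hXs : ∀ x ∈ K ∪ Y, star x ∈ K ∪ Y := by
    rintro x (hx | hx)
    · exact .inl (star_mem_mul_mul hgs hx)
    · exact .inr (star_mem_annihilatorPerp (fun x hx => star_mem_mul_mul hqs hx) hx)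
  -- `f` belongs to the annihilator of `K ∪ Y`
  have hfJ : f ∈ annihilatorSubmodule (K ∪ Y) := by
    rintro x (⟨a, b, rfl⟩ | hx)
    · refine ⟨?_, ?_⟩
      · calc f * (a * g * b) = f * (q * a * q) * g * b := by
              conv_lhs => rw [← hfq, ← hqg]
              simp only [mul_assoc]
          _ = q * a * q * (f * g) * b := by rw [(hcomm a).eq]; simp only [mul_assoc]
          _ = 0 := by rw [hfg, mul_zero, zero_mul]
      · calc a * g * b * f = a * g * (q * b * q * f) := by
              conv_lhs => rw [← hqf, ← hgq]
              simp only [mul_assoc]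
          _ = a * (g * f) * (q * b * q) := by rw [← (hcomm b).eq]; simp only [mul_assoc]
          _ = 0 := by rw [hgf, mul_zero, zero_mul]
    · exact (hx f ⟨f, q, by rw [mul_assoc, hq, (univ E).P_mul_self, ← hq, hfq]⟩).symm
  obtain ⟨d, hdJ, hdD, hd⟩ := h _ hX.isRegularIdeal fun hbot => by
    rw [hbot] at hfJ
    exact hf hfJ
  have hgg : g * g ≠ 0 := by
    intro h0
    nth_rw 1 [← hgs] at h0
    exact hg ((CStarRing.star_mul_self_eq_zero_iff _).1 h0)
  -- an element of the diagonal which annihilates `K` annihilates the paths which start on the cycle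
  have key : ∀ d ∈ annihilatorPerp (K ∪ Y), d ∈ diagonal E → ∀ a, d * a * q = 0 := by
    intro d hdJ hdD
    refine C.mul_mul_P_eq_zero hE fun μ hμ => ?_
    obtain ⟨r, hr⟩ := Submodule.mem_span_singleton.1 (C.diagonal_mul_path_mem hE hdD hμ)
    set t := (univ E).path μ (C.vertex 0)
    have h1 : d * (t * g * g) = 0 := (hdJ _ (.inl ⟨t, g, rfl⟩)).1
    have h2 : r • (g * g) = 0 := by
      calc r • (g * g) = star t * (r • t) * g * g := by
            rw [mul_smul_comm, CKFamily.star_path_mul_path_self _ hE hμ, ← hq, smul_mul_assoc,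
              smul_mul_assoc, hqg]
        _ = star t * (d * (t * g * g)) := by rw [hr]; simp only [mul_assoc]
        _ = 0 := by rw [h1, mul_zero]
    rw [← hr, (smul_eq_zero.1 h2).resolve_right hgg, zero_smul]
  have hsdJ : star d ∈ annihilatorPerp (K ∪ Y) := star_mem_annihilatorPerp hXs hdJ
  have hsdD : star d ∈ diagonal E := star_mem hdD
  have hsdY : star d ∈ Y := by
    rintro _ ⟨a, b, rfl⟩
    refine ⟨?_, ?_⟩
    · rw [← mul_assoc, ← mul_assoc, key _ hsdJ hsdD, zero_mul]
    · have h1 := congrArg star (key d hdJ hdD (star b))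
      rw [star_mul, star_mul, star_star, hqs, star_zero] at h1
      rw [mul_assoc, mul_assoc, h1, mul_zero]
  exact hd ((CStarRing.mul_star_self_eq_zero_iff _).1 (hdJ _ (.inr hsdY)).1)

end DirectedGraph

end

theorem mainTheorem9 {V W : Type*} (E : DirectedGraph V W) (hE : E.RowFinite) :
    List.TFAE
      [E.ConditionL,
       HasIdealIntersectionProperty (DirectedGraph.CStarAlg.diagonal E),
       HasRegularIdealIntersectionProperty (DirectedGraph.CStarAlg.diagonal E)] := by
  tfae_have 1 → 2 := E.hasIdealIntersectionProperty_of_conditionL hE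
  tfae_have 2 → 3 := fun h J hJ => h J hJ.1
  tfae_have 3 → 1 := E.conditionL_of_hasRegularIdealIntersectionProperty hE
  tfae_finish
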